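/- Work on the triangular lattice, drawn so that one family of lattice lines is horizontal. A lozenge is the union of two unit triangles sharing a side, a lozenge tiling of a bounded region \(G\) is a collection of non-overlapping lozenges whose union is \(G\), and \(M(G)\) is the number of lozenge tilings of \(G\). Write \([n]=\{1,\dots,n\}\). For non-negative integers \(a,b,c\) with \(c\le a+b\), let \(V_{a,b,c}\) be the hexagon with side lengths \(a,b,c,a+b-c,c,b\) (clockwise from the top side). Its horizontal diagonal \(\ell\) has length \(a+b\); label the unit segments of \(\ell\) by \(1,\dots,a+b\) from left to right. For \(X,Y\subseteq[a+b]\), let \(V_{a,b,c}(X,Y)\) be the region obtained from \(V_{a,b,c}\) by removing the up-pointing unit triangles whose bases are the segments of \(\ell\) labeled by the elements of \(X\) and the down-pointing unit triangles whose bases are the segments of \(\ell\) labeled by the elements of \(Y\). Say that \((X',Y')\) is a shuffling of \((X,Y)\) if \(X\cup Y=X'\cup Y'\) and \(X\cap Y=X'\cap Y'\). **Theorem.** Let \(a,b,c\) be non-negative integers and \(X,Y\subseteq[a+b]\) such that (i) \(c\le a+b\), and (ii) \(0\le b-|X|=c-|Y|\le|[a+b]\setminus(X\cup Y)|\). In \(V_{a,b,c}(X,Y)\),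 flip \(d\) of the removed up-pointing unit triangles along \(\ell\) down and \(u\) of the removed down-pointing ones up, leaving the pairs of removed triangles that form a vertical lozenge unchanged; that is, for some \(D\subseteq X\setminus Y\) and \(U\subseteq Y\setminus X\) with \(|D|=d\), \(|U|=u\), let \(X'=(X\setminus D)\cup U\) and \(Y'=(Y\setminus U)\cup D\). Modify the boundary of the hexagon so that its width \(a+b\) and height \(b+c\) are preserved but \(\ell\) moves up \(d-u\) units. Then \((X',Y')\) is a shuffling of \((X,Y)\), and this leads to a region \(V_{a',b',c'}(X',Y')\), where \(a',b',c'\) are the non-negative integers with \[a'+b'=a+b,\qquad b'+c'=b+c,\qquad c'=c+(d-u),\] and \(X',Y'\subseteq[a'+b']\) satisfy (i) and (ii) with respect to \(a',b',c'\); moreover \(c'\le a'+b'\) and \[b-|X|=c-|Y|=b'-|X'|=c'-|Y'|\ge 0 .\] Furthermore \(M(V_{a,b,c}(X,Y))>0\) and \[\frac{M(V_{a',b',c'}(X',Y'))}{M(V_{a,b,c}(X,Y))}=\frac{H(b)H(c)}{H(b')H(c')}\cdot\frac{\Delta(X')\Delta(Y')}{\Delta(X)\Delta(Y)},\] where \(\Delta(S)=\prod_{s,s'\in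 S,\ s<s'}(s'-s)\) for a finite set \(S\) of integers and \(H(n)=\prod_{i=0}^{n-1}i!\). -/

import Mathlib

namespace Shuffling

/-- The unit triangles of the triangular lattice. The lattice point `(i, j) : ℤ × ℤ` stands for the
point `i * (1, 0) + j * (1/2, √3/2)` of the plane, so that one family of lattice lines is horizontal.
Both `up i j` and `down i j` have as base the horizontal unit segment from `(i, j)` to `(i + 1, j)`;
the first one lies above its base and the second one below it. -/
inductive UnitTriangle
  | up (i j : ℤ)
  | down (i j : ℤ)
  deriving DecidableEq

/-- The three vertices of a unit triangle, in lattice coordinates. -/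
def UnitTriangle.vertices : UnitTriangle → Finset (ℤ × ℤ)
  | .up i j => {(i, j), (i + 1, j), (i, j + 1)}
  | .down i j => {(i, j), (i + 1, j), (i + 1, j - 1)}

/-- A lozenge, given as the set of its unit triangles: two distinct unit triangles that are adjacent,
i.e. have a side (two vertices) in common. -/
def IsLozenge (L : Finset UnitTriangle) : Prop :=
  ∃ s ∈ L, ∃ t ∈ L, L = {s, t} ∧ s ≠ t ∧ (s.vertices ∩ t.vertices).card = 2

instance (L : Finset UnitTriangle) : Decidable (IsLozenge L) := by
  unfold IsLozenge; infer_instance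

/-- `T` is a lozenge tiling of the bounded region `G` (a finite set of unit triangles): a collection of
lozenges that do not overlap and whose union is `G`. -/
def IsLozengeTiling (G : Finset UnitTriangle) (T : Finset (Finset UnitTriangle)) : Prop :=
  (∀ L ∈ T, IsLozenge L) ∧ (∀ L ∈ T, ∀ L' ∈ T, L ≠ L' → Disjoint L L') ∧ T.biUnion id = G

instance (G : Finset UnitTriangle) (T : Finset (Finset UnitTriangle)) :
    Decidable (IsLozengeTiling G T) := by
  unfold IsLozengeTiling; infer_instance

/-- The finite set of all lozenge tilings of `G` (see `mem_lozengeTilings`). -/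
def lozengeTilings (G : Finset UnitTriangle) : Finset (Finset (Finset UnitTriangle)) :=
  (G.powerset.filter IsLozenge).powerset.filter (IsLozengeTiling G)

theorem mem_lozengeTilings {G : Finset UnitTriangle} {T : Finset (Finset UnitTriangle)} :
    T ∈ lozengeTilings G ↔ IsLozengeTiling G T := by
  simp only [lozengeTilings, Finset.mem_filter, Finset.mem_powerset, and_iff_right_iff_imp]
  rintro ⟨h1, -, h3⟩ L hL
  refine Finset.mem_filter.2 ⟨Finset.mem_powerset.2 ?_, h1 L hL⟩
  rw [← h3]
  exact Finset.subset_biUnion_of_mem id hL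

/-- `M(G)`, the number of lozenge tilings of `G`. -/
def M (G : Finset UnitTriangle) : ℕ := (lozengeTilings G).card

/-- The lattice points of the closed hexagon with side lengths `a`, `b`, `c`, `a + b - c`, `c`, `b`
(clockwise from the top side), where `c ≤ a + b`, placed so that its horizontal diagonal goes from
`(0, 0)` to `(a + b, 0)`. Its corners are, clockwise from the top left one,
`(0, b)`, `(a, b)`, `(a + b, 0)`, `(a + b, -c)`, `(c, -c)`, `(0, 0)`. -/
noncomputable def hexagonPoints (a b c : ℕ) : Finset (ℤ × ℤ) :=
  (Finset.Icc (0 : ℤ) (a + b) ×ˢ Finset.Icc (-c : ℤ) b).filter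
    fun p => 0 ≤ p.1 + p.2 ∧ p.1 + p.2 ≤ a + b

/-- The hexagon `V_{a,b,c}` as a region: the unit triangles contained in it. -/
noncomputable def hexagon (a b c : ℕ) : Finset UnitTriangle :=
  ((hexagonPoints a b c).image (fun p => .up p.1 p.2) ∪
    (hexagonPoints a b c).image (fun p => .down p.1 p.2)).filter
      fun t => t.vertices ⊆ hexagonPoints a b c

/-- The doubly-dented hexagon `V_{a,b,c}(X, Y)`. The unit segment labelled `s`, for `1 ≤ s ≤ a + b`,
of the horizontal diagonal goes from `(s - 1, 0)` to `(s, 0)`. -/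
noncomputable def dentedHexagon (a b c : ℕ) (X Y : Finset ℕ) : Finset UnitTriangle :=
  hexagon a b c \
    (X.image (fun s : ℕ => .up ((s : ℤ) - 1) 0) ∪ Y.image (fun s : ℕ => .down ((s : ℤ) - 1) 0))

/-- `(X', Y')` is a shuffling of `(X, Y)`. -/
def IsShuffling (X Y X' Y' : Finset ℕ) : Prop :=
  X ∪ Y = X' ∪ Y' ∧ X ∩ Y = X' ∩ Y'

/-- `(X', Y')` records the positions of the removed up- and down-pointing unit triangles after `d` of
the up-pointing ones (at the positions in `D`) are flipped down and `u` of the down-pointing ones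
(at the positions in `U`) are flipped up, where the removed triangles that form a vertical lozenge
(those at the positions in `X ∩ Y`) are left as they are. -/
def IsFlip (X Y : Finset ℕ) (d u : ℕ) (X' Y' : Finset ℕ) : Prop :=
  ∃ D U : Finset ℕ, D ⊆ X \ Y ∧ U ⊆ Y \ X ∧ D.card = d ∧ U.card = u ∧
    X' = (X \ D) ∪ U ∧ Y' = (Y \ U) ∪ D

/-- `Δ(S)`, the product of `s' - s` over all `s < s'` in `S`. -/
def Δ (S : Finset ℕ) : ℚ :=
  ∏ p ∈ (S ×ˢ S).filter (fun p => p.1 < p.2), ((p.2 : ℚ) - p.1)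

/-- `H(n) = 0! 1! ⋯ (n-1)!`. -/
def H (n : ℕ) : ℚ := ∏ i ∈ Finset.range n, (i.factorial : ℚ)

end Shuffling

namespace Shuffling

open Finset UnitTriangle

/-! Cut the dented hexagon along ℓ. A tiling amounts to the set Z of segments of ℓ crossed by
vertical lozenges, which avoids X ∪ Y, together with tilings of the two halves, which are trapezoids
with dents along ℓ at X ∪ Z and at Y ∪ Z. By the formula of Cohn, Larsen and Propp (`M_trapezoid`),
a trapezoid of height n with dents S has Δ(S)/H(n) tilings if |S| = n and none otherwise. So only
sets Z of size k = b - |X| = c - |Y| contribute, and M · H(b)H(c) is the sum of Δ(X ∪ Z)Δ(Y ∪ Z)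
over them (`M_dentedHexagon`).

Now Δ(X ∪ Z) = Δ(X) Δ(Z) ∏ |x - z| (`vdm_union`), and the mixed products for X and for Y multiply to
one that involves X ∪ Y and X ∩ Y only (`cross_mul_cross`). Hence the sum is Δ(X)Δ(Y) times a
positive quantity, `shuffleSum`, that depends on a + b, k, X ∪ Y and X ∩ Y. A flip preserves all
four, so this quantity cancels from the ratio and never has to be evaluated.

The trapezoid formula follows by induction on the height. The bottom row, with dents S below and Z
above, has one tiling if Z interlaces S and none otherwise (`M_strip`). It remains to sum Δ(Z) over
all Z interlacing S, which gives Δ(S)/n! for |S| = n + 1; this is row reduction of a Vandermonde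
determinant (`sum_piFinset_det_vandermonde`). -/

/-! ### Lozenges and tilings. -/

/-- The three lozenges that contain a given down-pointing unit triangle. -/
theorem isLozenge_iff {L : Finset UnitTriangle} :
    IsLozenge L ↔ ∃ i j : ℤ, L = {down i j, up i j} ∨ L = {down i j, up i (j - 1)} ∨
      L = {down i j, up (i + 1) (j - 1)} := by
  have key : ∀ i j k l : ℤ, ((down i j).vertices ∩ (up k l).vertices).card = 2 →
      (k = i ∧ l = j) ∨ (k = i ∧ l = j - 1) ∨ (k = i + 1 ∧ l = j - 1) := by
    intro i j k l h
    obtain ⟨p, q, hpq, h⟩ := Finset.card_eq_two.1 h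
    have hp : p ∈ (down i j).vertices ∩ (up k l).vertices := by rw [h]; simp
    have hq : q ∈ (down i j).vertices ∩ (up k l).vertices := by rw [h]; simp
    obtain ⟨p1, p2⟩ := p
    obtain ⟨q1, q2⟩ := q
    simp only [vertices, mem_inter, mem_insert, mem_singleton, Prod.mk.injEq, ne_eq] at hp hq hpq
    omega
  constructor
  · rintro ⟨s, -, t, -, rfl, hst, h⟩
    rcases s with ⟨i, j⟩ | ⟨i, j⟩ <;> rcases t with ⟨k, l⟩ | ⟨k, l⟩
    -- Two distinct triangles of the same orientation share at most one vertex.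
    · exfalso
      obtain ⟨p, q, hpq, h⟩ := Finset.card_eq_two.1 h
      have hp : p ∈ (up i j).vertices ∩ (up k l).vertices := by rw [h]; simp
      have hq : q ∈ (up i j).vertices ∩ (up k l).vertices := by rw [h]; simp
      obtain ⟨p1, p2⟩ := p
      obtain ⟨q1, q2⟩ := q
      simp only [vertices, mem_inter, mem_insert, mem_singleton, Prod.mk.injEq, ne_eq, up.injEq]
        at hp hq hpq hst
      omega
    · rw [inter_comm] at h
      refine ⟨k, l, ?_⟩
      rw [pair_comm]
      rcases key _ _ _ _ h with ⟨rfl, rfl⟩ | ⟨rfl, rfl⟩ | ⟨rfl, rfl⟩ <;> simp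
    · refine ⟨i, j, ?_⟩
      rcases key _ _ _ _ h with ⟨rfl, rfl⟩ | ⟨rfl, rfl⟩ | ⟨rfl, rfl⟩ <;> simp
    · exfalso
      obtain ⟨p, q, hpq, h⟩ := Finset.card_eq_two.1 h
      have hp : p ∈ (down i j).vertices ∩ (down k l).vertices := by rw [h]; simp
      have hq : q ∈ (down i j).vertices ∩ (down k l).vertices := by rw [h]; simp
      obtain ⟨p1, p2⟩ := p
      obtain ⟨q1, q2⟩ := q
      simp only [vertices, mem_inter, mem_insert, mem_singleton, Prod.mk.injEq, ne_eq, down.injEq]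
        at hp hq hpq hst
      omega
  · have aux : ∀ i j k l : ℤ, (k = i ∧ l = j) ∨ (k = i ∧ l = j - 1) ∨ (k = i + 1 ∧ l = j - 1) →
        IsLozenge {down i j, up k l} := by
      intro i j k l h
      refine ⟨down i j, by simp, up k l, by simp, rfl, by simp, ?_⟩
      rw [Finset.card_eq_two]
      rcases h with ⟨rfl, rfl⟩ | ⟨rfl, rfl⟩ | ⟨rfl, rfl⟩
      · refine ⟨(k, l), (k + 1, l), by simp, ?_⟩
        ext ⟨x, y⟩
        simp only [vertices, mem_inter, mem_insert, mem_singleton, Prod.mk.injEq]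
        omega
      · refine ⟨(k, j), (k + 1, j - 1), by simp, ?_⟩
        ext ⟨x, y⟩
        simp only [vertices, mem_inter, mem_insert, mem_singleton, Prod.mk.injEq]
        omega
      · refine ⟨(i + 1, j), (i + 1, j - 1), by simp only [ne_eq, Prod.mk.injEq]; omega, ?_⟩
        ext ⟨x, y⟩
        simp only [vertices, mem_inter, mem_insert, mem_singleton, Prod.mk.injEq]
        omega
    rintro ⟨i, j, rfl | rfl | rfl⟩ <;> exact aux _ _ _ _ (by omega)

/-- A tiling assigns to each unit triangle the other half of its lozenge. -/
theorem IsLozengeTiling.exists_partner {G : Finset UnitTriangle} {T : Finset (Finset UnitTriangle)}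
    (hT : IsLozengeTiling G T) :
    ∃ f : UnitTriangle → UnitTriangle,
      ∀ x ∈ G, f x ∈ G ∧ f (f x) = x ∧ {x, f x} ∈ T ∧ IsLozenge {x, f x} := by
  obtain ⟨h1, h2, rfl⟩ := hT
  have : ∀ x ∈ T.biUnion id, ∃ y, {x, y} ∈ T := by
    intro x hx
    obtain ⟨L, hL, hx⟩ := mem_biUnion.1 hx
    obtain ⟨s, -, t, -, rfl, -, -⟩ := h1 L hL
    simp only [id, mem_insert, mem_singleton] at hx
    rcases hx with rfl | rfl
    · exact ⟨t, hL⟩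
    · exact ⟨s, by rwa [pair_comm]⟩
  choose! f hf using this
  refine ⟨f, fun x hx => ?_⟩
  have hm : f x ∈ T.biUnion id := mem_biUnion.2 ⟨_, hf x hx, by simp⟩
  refine ⟨hm, ?_, hf x hx, h1 _ (hf x hx)⟩
  have heq : ({x, f x} : Finset UnitTriangle) = {f x, f (f x)} := by
    by_contra hne
    exact Finset.disjoint_left.1 (h2 _ (hf x hx) _ (hf _ hm) hne)
      (show f x ∈ ({x, f x} : Finset UnitTriangle) by simp) (by simp)
  have hne : ∀ x ∈ T.biUnion id, f x ≠ x := by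
    intro x hx h
    obtain ⟨s, hs, t, ht, -, hst, -⟩ := h1 _ (hf x hx)
    rw [h] at hs ht
    simp at hs ht
    exact hst (hs.trans ht.symm)
  have : f (f x) ∈ ({x, f x} : Finset UnitTriangle) := by rw [heq]; simp
  simp only [mem_insert, mem_singleton] at this
  exact this.resolve_right (hne _ hm)

/-- Every lozenge of a tiling is determined by any of its unit triangles. -/
theorem IsLozengeTiling.eq_of_mem {G : Finset UnitTriangle} {T : Finset (Finset UnitTriangle)}
    (hT : IsLozengeTiling G T) {L L' : Finset UnitTriangle} (hL : L ∈ T) (hL' : L' ∈ T)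
    {x : UnitTriangle} (hx : x ∈ L) (hx' : x ∈ L') : L = L' := by
  by_contra h
  exact disjoint_left.1 (hT.2.1 L hL L' hL' h) hx hx'

theorem IsLozenge.nonempty {L : Finset UnitTriangle} (hL : IsLozenge L) : L.Nonempty := by
  obtain ⟨s, hs, -⟩ := hL
  exact ⟨s, hs⟩

/-- The lozenges contained in a part of the region that is tiled by lozenges form a tiling of it. -/
theorem IsLozengeTiling.filter {G : Finset UnitTriangle} {T : Finset (Finset UnitTriangle)}
    (hT : IsLozengeTiling G T) {A : Finset UnitTriangle} (hA : A ⊆ G)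
    (h : ∀ L ∈ T, ∀ x ∈ L, x ∈ A → L ⊆ A) : IsLozengeTiling A (T.filter (· ⊆ A)) := by
  refine ⟨fun L hL => hT.1 L (mem_filter.1 hL).1,
    fun L hL L' hL' => hT.2.1 L (mem_filter.1 hL).1 L' (mem_filter.1 hL').1, ?_⟩
  ext x
  simp only [mem_biUnion, mem_filter, id]
  constructor
  · rintro ⟨L, ⟨-, hL⟩, hx⟩
    exact hL hx
  · intro hx
    have := hA hx
    rw [← hT.2.2] at this
    obtain ⟨L, hL, hxL⟩ := mem_biUnion.1 this
    exact ⟨L, ⟨hL, h L hL x hxL hx⟩, hxL⟩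

/-- Tilings of disjoint regions combine to a tiling of the union. -/
theorem IsLozengeTiling.union {A B : Finset UnitTriangle} {T T' : Finset (Finset UnitTriangle)}
    (hT : IsLozengeTiling A T) (hT' : IsLozengeTiling B T') (hAB : Disjoint A B) :
    IsLozengeTiling (A ∪ B) (T ∪ T') := by
  have hd : ∀ L ∈ T, ∀ L' ∈ T', Disjoint L L' := by
    intro L hL L' hL'
    refine hAB.mono ?_ ?_
    · rw [← hT.2.2]; exact subset_biUnion_of_mem id hL
    · rw [← hT'.2.2]; exact subset_biUnion_of_mem id hL'
  refine ⟨?_, ?_, ?_⟩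
  · intro L hL
    rcases mem_union.1 hL with h | h
    exacts [hT.1 L h, hT'.1 L h]
  · intro L hL L' hL' hne
    rcases mem_union.1 hL with h | h <;> rcases mem_union.1 hL' with h' | h'
    exacts [hT.2.1 L h L' h' hne, hd L h L' h', (hd L' h' L h).symm, hT'.2.1 L h L' h' hne]
  · rw [union_biUnion, hT.2.2, hT'.2.2]

theorem IsLozengeTiling.subset {G : Finset UnitTriangle} {T : Finset (Finset UnitTriangle)}
    (hT : IsLozengeTiling G T) {L : Finset UnitTriangle} (hL : L ∈ T) : L ⊆ G := by
  rw [← hT.2.2]; exact subset_biUnion_of_mem id hL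

/-! ### Cutting and transporting regions. -/

/-- Cutting a region into two parts, where the lozenges across the cut are `{u z, d z}`. -/
theorem M_eq_sum_cut {p : UnitTriangle → Prop} [DecidablePred p] {u d : ℤ → UnitTriangle}
    (hu : ∀ z, p (u z)) (hd : ∀ z, ¬ p (d z)) (hu_inj : Function.Injective u)
    (hd_inj : Function.Injective d) (hloz : ∀ z, IsLozenge {u z, d z})
    (hcut : ∀ L, IsLozenge L → (∀ x ∈ L, p x) ∨ (∀ x ∈ L, ¬ p x) ∨ ∃ z, L = {u z, d z})
    (G : Finset UnitTriangle) (I : Finset ℤ) (hI : ∀ z, z ∈ I ↔ u z ∈ G ∧ d z ∈ G) :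
    M G = ∑ Z ∈ I.powerset,
      M (G.filter p \ Z.image u) * M (G.filter (fun x => ¬ p x) \ Z.image d) := by
  have huI : ∀ z ∈ I, u z ∈ G := fun z hz => ((hI z).1 hz).1
  have hdI : ∀ z ∈ I, d z ∈ G := fun z hz => ((hI z).1 hz).2
  -- Tilings are sorted by the set of lozenges across the cut that they use.
  have hmap : ∀ T ∈ lozengeTilings G, (I.filter fun z => {u z, d z} ∈ T) ∈ I.powerset :=
    fun T _ => mem_powerset.2 (filter_subset _ _)
  rw [M, card_eq_sum_card_fiberwise hmap]
  refine sum_congr rfl fun Z hZ => ?_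
  rw [mem_powerset] at hZ
  rw [M, M, ← card_product]
  set A := G.filter p \ Z.image u with hA
  set B := G.filter (fun x => ¬ p x) \ Z.image d with hB
  set C : Finset (Finset UnitTriangle) := Z.image fun z => {u z, d z} with hC
  have hAp : ∀ x ∈ A, p x := fun x hx => (mem_filter.1 (mem_sdiff.1 hx).1).2
  have hBp : ∀ x ∈ B, ¬ p x := fun x hx => (mem_filter.1 (mem_sdiff.1 hx).1).2
  have hAG : A ⊆ G := sdiff_subset.trans (filter_subset _ _)
  have hBG : B ⊆ G := sdiff_subset.trans (filter_subset _ _)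
  have hAB : Disjoint A B := disjoint_left.2 fun x hx hx' => hBp x hx' (hAp x hx)
  have hCt : IsLozengeTiling (Z.image u ∪ Z.image d) C := by
    refine ⟨?_, ?_, ?_⟩
    · intro L hL
      obtain ⟨z, -, rfl⟩ := mem_image.1 hL
      exact hloz z
    · intro L hL L' hL' hne
      obtain ⟨z, -, rfl⟩ := mem_image.1 hL
      obtain ⟨w, -, rfl⟩ := mem_image.1 hL'
      have hzw : z ≠ w := by rintro rfl; exact hne rfl
      rw [disjoint_left]
      intro x hx hx'
      simp only [mem_insert, mem_singleton] at hx hx'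
      rcases hx with rfl | rfl <;> rcases hx' with h | h
      · exact hzw (hu_inj h)
      · exact hd w (h ▸ hu z)
      · exact hd z (h ▸ hu w)
      · exact hzw (hd_inj h)
    · ext x
      simp only [hC, mem_biUnion, mem_image, id, mem_union]
      constructor
      · rintro ⟨_, ⟨z, hz, rfl⟩, hx⟩
        simp only [mem_insert, mem_singleton] at hx
        rcases hx with rfl | rfl
        exacts [Or.inl ⟨z, hz, rfl⟩, Or.inr ⟨z, hz, rfl⟩]
      · rintro (⟨z, hz, rfl⟩ | ⟨z, hz, rfl⟩) <;> exact ⟨_, ⟨z, hz, rfl⟩, by simp⟩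
  have hG : (A ∪ B) ∪ (Z.image u ∪ Z.image d) = G := by
    ext x
    simp only [hA, hB, mem_union, mem_sdiff, mem_filter]
    constructor
    · rintro ((⟨⟨h, -⟩, -⟩ | ⟨⟨h, -⟩, -⟩) | h | h)
      · exact h
      · exact h
      · obtain ⟨z, hz, rfl⟩ := mem_image.1 h
        exact huI z (hZ hz)
      · obtain ⟨z, hz, rfl⟩ := mem_image.1 h
        exact hdI z (hZ hz)
    · tauto
  have hABC : Disjoint (A ∪ B) (Z.image u ∪ Z.image d) := by
    rw [disjoint_left]
    intro x hx hx'
    rcases mem_union.1 hx' with h | h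
    · rcases mem_union.1 hx with h' | h'
      · exact (mem_sdiff.1 h').2 h
      · obtain ⟨z, -, rfl⟩ := mem_image.1 h
        exact hBp _ h' (hu z)
    · rcases mem_union.1 hx with h' | h'
      · obtain ⟨z, -, rfl⟩ := mem_image.1 h
        exact hd z (hAp _ h')
      · exact (mem_sdiff.1 h').2 h
  refine card_nbij' (fun T => (T.filter (· ⊆ A), T.filter (· ⊆ B)))
    (fun P => (P.1 ∪ P.2) ∪ C) ?_ ?_ ?_ ?_
  · intro T hT
    rw [mem_coe, mem_filter, mem_lozengeTilings] at hT
    obtain ⟨hT, hTZ⟩ := hT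
    have hmem : ∀ z ∈ Z, {u z, d z} ∈ T := by
      intro z hz
      rw [← hTZ] at hz
      exact (mem_filter.1 hz).2
    have hcross : ∀ z, {u z, d z} ∈ T → z ∈ Z := by
      intro z hz
      rw [← hTZ, mem_filter]
      exact ⟨(hI z).2 ⟨hT.subset hz (by simp), hT.subset hz (by simp)⟩, hz⟩
    rw [mem_coe, mem_product, mem_lozengeTilings, mem_lozengeTilings]
    refine ⟨hT.filter hAG ?_, hT.filter hBG ?_⟩
    · intro L hL x hx hxA
      rcases hcut L (hT.1 L hL) with h | h | ⟨z, rfl⟩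
      · intro y hy
        refine mem_sdiff.2 ⟨mem_filter.2 ⟨hT.subset hL hy, h y hy⟩, fun hy' => ?_⟩
        obtain ⟨z, hz, rfl⟩ := mem_image.1 hy'
        have := hT.eq_of_mem hL (hmem z hz) hy (by simp)
        exact hd z (h _ (this ▸ by simp))
      · exact absurd (hAp x hxA) (h x hx)
      · have hz := hcross z hL
        simp only [mem_insert, mem_singleton] at hx
        rcases hx with rfl | rfl
        · exact absurd (mem_image_of_mem u hz) (mem_sdiff.1 hxA).2
        · exact absurd (hAp _ hxA) (hd z)
    · intro L hL x hx hxB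
      rcases hcut L (hT.1 L hL) with h | h | ⟨z, rfl⟩
      · exact absurd (h x hx) (hBp x hxB)
      · intro y hy
        refine mem_sdiff.2 ⟨mem_filter.2 ⟨hT.subset hL hy, h y hy⟩, fun hy' => ?_⟩
        obtain ⟨z, hz, rfl⟩ := mem_image.1 hy'
        have := hT.eq_of_mem hL (hmem z hz) hy (by simp)
        exact h (u z) (this ▸ by simp) (hu z)
      · have hz := hcross z hL
        simp only [mem_insert, mem_singleton] at hx
        rcases hx with rfl | rfl
        · exact absurd (hu z) (hBp _ hxB)
        · exact absurd (mem_image_of_mem d hz) (mem_sdiff.1 hxB).2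
  · rintro ⟨T₁, T₂⟩ h
    rw [mem_coe, mem_product, mem_lozengeTilings, mem_lozengeTilings] at h
    obtain ⟨h₁, h₂⟩ := h
    dsimp only at h₁ h₂
    rw [mem_coe, mem_filter, mem_lozengeTilings]
    refine ⟨hG ▸ (h₁.union h₂ hAB).union hCt hABC, ?_⟩
    ext z
    simp only [mem_filter, mem_union]
    constructor
    · rintro ⟨-, (h | h) | h⟩
      · exact absurd (hAp _ (h₁.subset h (by simp : d z ∈ _))) (hd z)
      · exact absurd (hu z) (hBp _ (h₂.subset h (by simp : u z ∈ _)))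
      · have := hCt.subset h (by simp : u z ∈ _)
        rcases mem_union.1 this with h | h
        · obtain ⟨w, hw, hwz⟩ := mem_image.1 h
          rwa [← hu_inj hwz]
        · obtain ⟨w, hw, hwz⟩ := mem_image.1 h
          exact absurd (hwz ▸ hu z) (hd w)
    · intro hz
      exact ⟨hZ hz, Or.inr (mem_image_of_mem _ hz)⟩
  · intro T hT
    rw [mem_coe, mem_filter, mem_lozengeTilings] at hT
    obtain ⟨hT, hTZ⟩ := hT
    have hmem : ∀ z ∈ Z, {u z, d z} ∈ T := by
      intro z hz
      rw [← hTZ] at hz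
      exact (mem_filter.1 hz).2
    ext L
    simp only [mem_union, mem_filter]
    constructor
    · rintro ((h | h) | h)
      · exact h.1
      · exact h.1
      · obtain ⟨z, hz, rfl⟩ := mem_image.1 h
        exact hmem z hz
    · intro hL
      rcases hcut L (hT.1 L hL) with h | h | ⟨z, rfl⟩
      · refine Or.inl (Or.inl ⟨hL, fun y hy => mem_sdiff.2 ⟨mem_filter.2 ⟨hT.subset hL hy, h y hy⟩,
          fun hy' => ?_⟩⟩)
        obtain ⟨z, hz, rfl⟩ := mem_image.1 hy'
        have := hT.eq_of_mem hL (hmem z hz) hy (by simp)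
        exact hd z (h _ (this ▸ by simp))
      · refine Or.inl (Or.inr ⟨hL, fun y hy => mem_sdiff.2 ⟨mem_filter.2 ⟨hT.subset hL hy, h y hy⟩,
          fun hy' => ?_⟩⟩)
        obtain ⟨z, hz, rfl⟩ := mem_image.1 hy'
        have := hT.eq_of_mem hL (hmem z hz) hy (by simp)
        exact h (u z) (this ▸ by simp) (hu z)
      · refine Or.inr (mem_image.2 ⟨z, ?_, rfl⟩)
        rw [← hTZ, mem_filter]
        exact ⟨(hI z).2 ⟨hT.subset hL (by simp), hT.subset hL (by simp)⟩, hL⟩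
  · rintro ⟨T₁, T₂⟩ h
    rw [mem_coe, mem_product, mem_lozengeTilings, mem_lozengeTilings] at h
    obtain ⟨h₁, h₂⟩ := h
    dsimp only at h₁ h₂
    have hsub : ∀ L ∈ C, ¬ L ⊆ A ∧ ¬ L ⊆ B := by
      intro L hL
      obtain ⟨z, -, rfl⟩ := mem_image.1 hL
      exact ⟨fun h => hd z (hAp _ (h (by simp))), fun h => hBp _ (h (by simp : u z ∈ _)) (hu z)⟩
    -- As lozenges are nonempty, none lies in both A and B, so filtering the union recovers the two
    -- tilings.
    have hT₁ : ∀ L ∈ T₁, L ⊆ A ∧ ¬ L ⊆ B := by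
      intro L hL
      obtain ⟨x, hx⟩ := (h₁.1 L hL).nonempty
      exact ⟨h₁.subset hL, fun h => hBp x (h hx) (hAp x (h₁.subset hL hx))⟩
    have hT₂ : ∀ L ∈ T₂, L ⊆ B ∧ ¬ L ⊆ A := by
      intro L hL
      obtain ⟨x, hx⟩ := (h₂.1 L hL).nonempty
      exact ⟨h₂.subset hL, fun h => hBp x (h₂.subset hL hx) (hAp x (h hx))⟩
    refine Prod.ext ?_ ?_
    · ext L
      have := hsub L; have := hT₁ L; have := hT₂ L
      simp only [mem_filter, mem_union]
      tauto
    · ext L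
      have := hsub L; have := hT₁ L; have := hT₂ L
      simp only [mem_filter, mem_union]
      tauto

/-- The number of tilings is invariant under a bijection that preserves lozenges. -/
theorem M_image (e : UnitTriangle ≃ UnitTriangle)
    (he : ∀ L : Finset UnitTriangle, IsLozenge L → IsLozenge (L.image e))
    (he' : ∀ L : Finset UnitTriangle, IsLozenge L → IsLozenge (L.image e.symm))
    (G : Finset UnitTriangle) : M (G.image e) = M G := by
  have aux : ∀ e : UnitTriangle ≃ UnitTriangle,
      (∀ L : Finset UnitTriangle, IsLozenge L → IsLozenge (L.image e)) →
      ∀ G : Finset UnitTriangle, M G ≤ M (G.image e) := by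
    intro e he G
    refine card_le_card_of_injOn (fun T => T.image (fun L => L.image e)) ?_ ?_
    · intro T hT
      rw [mem_coe, mem_lozengeTilings] at hT ⊢
      refine ⟨?_, ?_, ?_⟩
      · intro L hL
        obtain ⟨K, hK, rfl⟩ := mem_image.1 hL
        exact he K (hT.1 K hK)
      · intro L hL L' hL' hne
        obtain ⟨K, hK, rfl⟩ := mem_image.1 hL
        obtain ⟨K', hK', rfl⟩ := mem_image.1 hL'
        exact (disjoint_image e.injective).2 (hT.2.1 K hK K' hK' fun h => hne (by rw [h]))
      · rw [← hT.2.2, image_biUnion, biUnion_image]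
        rfl
    · exact (image_injective (image_injective e.injective)).injOn
  refine le_antisymm ?_ (aux e he G)
  have := aux e.symm he' (G.image e)
  rwa [image_image, Equiv.symm_comp_self, image_id] at this

/-! ### Strips of height one and interlacing dents. -/

/-- A horizontal strip of unit height with `m + 1` up-pointing and `m` down-pointing unit triangles,
from which the up-pointing ones at `S` and the down-pointing ones at `Z` are removed. -/
noncomputable def strip (j m : ℤ) (S Z : Finset ℤ) : Finset UnitTriangle :=
  (Ico 0 (m + 1) \ S).image (fun i => up i j) ∪ (Ico 0 m \ Z).image (fun i => down i (j + 1))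

theorem up_mem_strip {j m : ℤ} {S Z : Finset ℤ} {i k : ℤ} :
    up i k ∈ strip j m S Z ↔ k = j ∧ 0 ≤ i ∧ i < m + 1 ∧ i ∉ S := by
  simp only [strip, mem_union, mem_image, mem_sdiff, mem_Ico, up.injEq, reduceCtorEq, and_false,
    exists_false, or_false]
  constructor
  · rintro ⟨x, ⟨⟨h1, h2⟩, h3⟩, rfl, rfl⟩
    exact ⟨rfl, h1, h2, h3⟩
  · rintro ⟨rfl, h1, h2, h3⟩
    exact ⟨i, ⟨⟨h1, h2⟩, h3⟩, rfl, rfl⟩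

theorem down_mem_strip {j m : ℤ} {S Z : Finset ℤ} {i k : ℤ} :
    down i k ∈ strip j m S Z ↔ k = j + 1 ∧ 0 ≤ i ∧ i < m ∧ i ∉ Z := by
  simp only [strip, mem_union, mem_image, mem_sdiff, mem_Ico, down.injEq, reduceCtorEq, and_false,
    exists_false, false_or]
  constructor
  · rintro ⟨x, ⟨⟨h1, h2⟩, h3⟩, rfl, rfl⟩
    exact ⟨rfl, h1, h2, h3⟩
  · rintro ⟨rfl, h1, h2, h3⟩
    exact ⟨i, ⟨⟨h1, h2⟩, h3⟩, rfl, rfl⟩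

theorem isLozenge_down_iff {i j : ℤ} {y : UnitTriangle} :
    IsLozenge {down i j, y} ↔ y = up i j ∨ y = up i (j - 1) ∨ y = up (i + 1) (j - 1) := by
  rw [isLozenge_iff]
  constructor
  · rintro ⟨k, l, h⟩
    have aux : ∀ k l k' l', ({down i j, y} : Finset UnitTriangle) = {down k l, up k' l'} →
        k = i ∧ l = j ∧ y = up k' l' := by
      intro k l k' l' h
      have h1 : down i j ∈ ({down k l, up k' l'} : Finset UnitTriangle) := h ▸ by simp
      have h2 : up k' l' ∈ ({down i j, y} : Finset UnitTriangle) := h ▸ by simp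
      simp only [mem_insert, mem_singleton, down.injEq, reduceCtorEq, or_false, false_or] at h1 h2
      exact ⟨h1.1.symm, h1.2.symm, h2.symm⟩
    rcases h with h | h | h <;> obtain ⟨rfl, rfl, rfl⟩ := aux _ _ _ _ h <;> simp
  · rintro (rfl | rfl | rfl) <;> exact ⟨i, j, by simp⟩

/-- In a tiling of a strip, the partner of a down-pointing triangle is one of its two up-pointing
neighbours, and conversely. -/
theorem exists_strip_partner {j m : ℤ} {S Z : Finset ℤ} {T : Finset (Finset UnitTriangle)}
    (hT : IsLozengeTiling (strip j m S Z) T) :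
    ∃ f : ℤ → ℤ,
      (∀ i, 0 ≤ i → i < m → i ∉ Z → {down i (j + 1), up (f i) j} ∈ T ∧ (f i = i ∨ f i = i + 1) ∧
        0 ≤ f i ∧ f i < m + 1 ∧ f i ∉ S) ∧
      (∀ k, 0 ≤ k → k < m + 1 → k ∉ S → ∃ i, 0 ≤ i ∧ i < m ∧ i ∉ Z ∧ f i = k) := by
  obtain ⟨g, hg⟩ := hT.exists_partner
  have h1 : ∀ i, 0 ≤ i → i < m → i ∉ Z → ∃ k, g (down i (j + 1)) = up k j ∧ (k = i ∨ k = i + 1) ∧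
        0 ≤ k ∧ k < m + 1 ∧ k ∉ S := by
    intro i hi0 him hiZ
    obtain ⟨hm, -, -, hl⟩ := hg _ (down_mem_strip.2 ⟨rfl, hi0, him, hiZ⟩)
    rcases isLozenge_down_iff.1 hl with h | h | h <;> rw [h, up_mem_strip] at hm
    · omega
    · exact ⟨i, by rw [h]; congr 1; omega, Or.inl rfl, hm.2⟩
    · exact ⟨i + 1, by rw [h]; congr 1; omega, Or.inr rfl, hm.2⟩
  choose! f hf using h1
  refine ⟨f, fun i hi0 him hiZ => ⟨?_, (hf i hi0 him hiZ).2⟩, fun k hk0 hkm hkS => ?_⟩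
  · rw [← (hf i hi0 him hiZ).1]
    exact (hg _ (down_mem_strip.2 ⟨rfl, hi0, him, hiZ⟩)).2.2.1
  · obtain ⟨hm, hgg, -, hl⟩ := hg _ (up_mem_strip.2 ⟨rfl, hk0, hkm, hkS⟩)
    rcases hy : g (up k j) with ⟨i, l⟩ | ⟨i, l⟩
    · rw [hy, isLozenge_iff] at hl
      obtain ⟨a, b, h | h | h⟩ := hl
      all_goals
        have h1 : down a b ∈ ({up k j, up i l} : Finset UnitTriangle) := h ▸ by simp
        simp at h1
    · rw [hy, down_mem_strip] at hm
      obtain ⟨rfl, h⟩ := hm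
      refine ⟨i, h.1, h.2.1, h.2.2, ?_⟩
      have h2 := (hf i h.1 h.2.1 h.2.2).1
      rw [← hy, hgg] at h2
      simpa using h2.symm

/-- Conditions for the tileability of a strip. -/
theorem interlace_of_isLozengeTiling {j m : ℤ} (hm : 0 ≤ m) {S Z : Finset ℤ}
    (hS : S ⊆ Ico 0 (m + 1)) (hZ : Z ⊆ Ico 0 m) {T : Finset (Finset UnitTriangle)}
    (hT : IsLozengeTiling (strip j m S Z) T) :
    Z.card + 1 = S.card ∧ ∀ s ∈ S, ∀ t ∈ S, s < t → ∃ z ∈ Z, s ≤ z ∧ z < t := by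
  obtain ⟨f, hf, hf'⟩ := exists_strip_partner hT
  have hinj : ∀ i i', 0 ≤ i → i < m → i ∉ Z → 0 ≤ i' → i' < m → i' ∉ Z → f i = f i' → i = i' := by
    intro i i' h1 h2 h3 h1' h2' h3' h
    have := hT.eq_of_mem (hf i h1 h2 h3).1 (hf i' h1' h2' h3').1 (x := up (f i) j) (by simp)
      (by simp [h])
    have hx : down i (j + 1) ∈ ({down i' (j + 1), up (f i') j} : Finset UnitTriangle) :=
      this ▸ by simp
    simpa using hx
  constructor
  · have hc : (Ico 0 m \ Z).card = (Ico 0 (m + 1) \ S).card := by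
      refine card_bij' (fun i _ => f i) (fun k hk => Classical.choose (hf' k
        (mem_Ico.1 (mem_sdiff.1 hk).1).1 (mem_Ico.1 (mem_sdiff.1 hk).1).2 (mem_sdiff.1 hk).2))
        ?_ ?_ ?_ ?_
      · intro i hi
        simp only [mem_sdiff, mem_Ico] at hi ⊢
        have := hf i hi.1.1 hi.1.2 hi.2
        tauto
      · intro k hk
        have := Classical.choose_spec (hf' k
          (mem_Ico.1 (mem_sdiff.1 hk).1).1 (mem_Ico.1 (mem_sdiff.1 hk).1).2 (mem_sdiff.1 hk).2)
        simp only [mem_sdiff, mem_Ico]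
        tauto
      · intro i hi
        have hi' := hi
        simp only [mem_sdiff, mem_Ico] at hi
        have h2 := (hf i hi.1.1 hi.1.2 hi.2).2.2
        have := Classical.choose_spec (hf' (f i) h2.1 h2.2.1 h2.2.2)
        exact hinj _ _ this.1 this.2.1 this.2.2.1 hi.1.1 hi.1.2 hi.2 this.2.2.2
      · intro k hk
        exact (Classical.choose_spec (hf' k (mem_Ico.1 (mem_sdiff.1 hk).1).1
          (mem_Ico.1 (mem_sdiff.1 hk).1).2 (mem_sdiff.1 hk).2)).2.2.2
    rw [card_sdiff_of_subset hS, card_sdiff_of_subset hZ, Int.card_Ico, Int.card_Ico] at hc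
    have h1 := card_le_card hS
    have h2 := card_le_card hZ
    rw [Int.card_Ico] at h1 h2
    omega
  · intro s hs t ht hst
    by_contra! hno
    have hs' := mem_Ico.1 (hS hs)
    have ht' := mem_Ico.1 (hS ht)
    have hZ' : ∀ i, s ≤ i → i < t → i ∉ Z := fun i h1 h2 h => absurd (hno i h h1) (by omega)
    -- Pigeonhole: if none of the t - s down-pointing triangles from s to t - 1 is removed, their
    -- partners are distinct and lie strictly between the dents s and t, where only t - s - 1 places
    -- exist.
    have hle : (Ico s t).card ≤ (Ioo s t).card := by
      refine card_le_card_of_injOn f ?_ ?_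
      · intro i hi
        rw [mem_coe, mem_Ico] at hi
        have := hf i (by omega) (by omega) (hZ' i hi.1 hi.2)
        have h1 : f i ≠ s := by rintro h; rw [h] at this; tauto
        have h2 : f i ≠ t := by rintro h; rw [h] at this; tauto
        rw [mem_coe, mem_Ioo]
        omega
      · intro i hi i' hi' h
        rw [mem_coe, mem_Ico] at hi hi'
        exact hinj i i' (by omega) (by omega) (hZ' i hi.1 hi.2) (by omega) (by omega)
          (hZ' i' hi'.1 hi'.2) h
    rw [Int.card_Ico, Int.card_Ioo] at hle
    omega

/-- A strip has at most one tiling. -/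
theorem strip_tiling_unique {j m : ℤ} {S Z : Finset ℤ}
    {T T' : Finset (Finset UnitTriangle)} (hT : IsLozengeTiling (strip j m S Z) T)
    (hT' : IsLozengeTiling (strip j m S Z) T') : T ⊆ T' := by
  -- Two tilings cannot first differ at n, counted from the left. If T pairs `down n` with `up n`
  -- and T' pairs it with `up (n + 1)`, then T' must cover `up n` by its left neighbour, and by
  -- agreement further left that lozenge is also in T, where it overlaps the first one.
  have key : ∀ (T T' : Finset (Finset UnitTriangle)), IsLozengeTiling (strip j m S Z) T →
      IsLozengeTiling (strip j m S Z) T' → ∀ n : ℕ, (n : ℤ) < m → (n : ℤ) ∉ Z →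
      (∀ k < n, (k : ℤ) < m → (k : ℤ) ∉ Z → ∀ l,
        ({down k (j + 1), up l j} : Finset UnitTriangle) ∈ T' → {down k (j + 1), up l j} ∈ T) →
      {down n (j + 1), up n j} ∈ T → {down n (j + 1), up (n + 1) j} ∈ T' → False := by
    intro T T' hT hT' n hn hnZ ih h h'
    have hup := up_mem_strip.1 (hT.subset h (by simp : up n j ∈ _))
    obtain ⟨f, hf, hf'⟩ := exists_strip_partner hT'
    obtain ⟨i, hi0, him, hiZ, hi⟩ := hf' n hup.2.1 hup.2.2.1 hup.2.2.2
    have hfi := hf i hi0 him hiZ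
    rw [hi] at hfi
    rcases hfi.2.1 with hni | hni
    · rw [← hni] at hfi
      have := hT'.eq_of_mem h' hfi.1 (x := down n (j + 1)) (by simp) (by simp)
      have hx : up (n + 1) j ∈ ({down n (j + 1), up n j} : Finset UnitTriangle) := this ▸ by simp
      simp at hx
    · lift i to ℕ using hi0
      have h2 := ih i (by omega) him hiZ _ hfi.1
      have := hT.eq_of_mem h h2 (x := up n j) (by simp) (by simp)
      have hx : down n (j + 1) ∈ ({down i (j + 1), up n j} : Finset UnitTriangle) := this ▸ by simp
      simp at hx
      omega
  have main : ∀ n : ℕ, (n : ℤ) < m → (n : ℤ) ∉ Z → ∃ l,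
      ({down n (j + 1), up l j} : Finset UnitTriangle) ∈ T ∧ {down n (j + 1), up l j} ∈ T' := by
    intro n
    induction n using Nat.strong_induction_on with
    | _ n ih =>
    intro hn hnZ
    have ih' : ∀ (T T' : Finset (Finset UnitTriangle)), IsLozengeTiling (strip j m S Z) T →
      (∀ k < n, (k : ℤ) < m → (k : ℤ) ∉ Z → ∃ l,
        ({down k (j + 1), up l j} : Finset UnitTriangle) ∈ T ∧ {down k (j + 1), up l j} ∈ T') →
      (∀ k < n, (k : ℤ) < m → (k : ℤ) ∉ Z → ∀ l,
        ({down k (j + 1), up l j} : Finset UnitTriangle) ∈ T → {down k (j + 1), up l j} ∈ T') := by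
      intro T T' hT h k hk hkm hkZ l hl
      obtain ⟨l', h1, h2⟩ := h k hk hkm hkZ
      rwa [hT.eq_of_mem hl h1 (x := down k (j + 1)) (by simp) (by simp)]
    obtain ⟨f, hf, -⟩ := exists_strip_partner hT
    obtain ⟨f', hf', -⟩ := exists_strip_partner hT'
    obtain ⟨h1, h2, -⟩ := hf n (by omega) hn hnZ
    obtain ⟨h1', h2', -⟩ := hf' n (by omega) hn hnZ
    by_cases h : f n = f' n
    · exact ⟨f n, h1, h ▸ h1'⟩
    · exfalso
      rcases h2 with h2 | h2 <;> rcases h2' with h2' | h2'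
      · omega
      · rw [h2] at h1; rw [h2'] at h1'
        exact key T T' hT hT' n hn hnZ (ih' T' T hT' fun k hk hkm hkZ =>
          (ih k hk hkm hkZ).imp fun _ h => h.symm) h1 h1'
      · rw [h2] at h1; rw [h2'] at h1'
        exact key T' T hT' hT n hn hnZ (ih' T T' hT ih) h1' h1
      · omega
  have hmem : ∀ L ∈ T, ∃ n : ℕ, (n : ℤ) < m ∧ (n : ℤ) ∉ Z ∧ down n (j + 1) ∈ L := by
    intro L hL
    have : ∃ k l, down k l ∈ L := by
      obtain ⟨k, l, h⟩ := isLozenge_iff.1 (hT.1 L hL)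
      exact ⟨k, l, by rcases h with rfl | rfl | rfl <;> simp⟩
    obtain ⟨k, l, hkl⟩ := this
    obtain ⟨rfl, h0, h1, h2⟩ := down_mem_strip.1 (hT.subset hL hkl)
    lift k to ℕ using h0
    exact ⟨k, h1, h2, hkl⟩
  intro L hL
  obtain ⟨n, hn, hnZ, hmemL⟩ := hmem L hL
  obtain ⟨l, h1, h2⟩ := main n hn hnZ
  rwa [hT.eq_of_mem hL h1 hmemL (by simp)]

/-- Interlacing sets of dents give a tileable strip. -/
theorem exists_strip_tiling {j m : ℤ} {S Z : Finset ℤ}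
    (hS : S ⊆ Ico 0 (m + 1)) (hZ : Z ⊆ Ico 0 m) (hcard : Z.card + 1 = S.card)
    (h : ∀ s ∈ S, ∀ t ∈ S, s < t → ∃ z ∈ Z, s ≤ z ∧ z < t) :
    ∃ T, IsLozengeTiling (strip j m S Z) T := by
  classical
  -- A dent s on the lower side pushes the down-pointing triangles from s onwards to their right
  -- partner, up to the next dent z on the upper side. `R i` says that i is in such a stretch; all
  -- other triangles take the left partner.
  let R : ℤ → Prop := fun i => ∃ s ∈ S, s ≤ i ∧ ∀ z ∈ Z, s ≤ z → i < z
  let p : ℤ → ℤ := fun i => if R i then i + 1 else i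
  have hp : ∀ i, (R i ∧ p i = i + 1) ∨ (¬ R i ∧ p i = i) := by
    intro i
    by_cases hR : R i
    · exact Or.inl ⟨hR, if_pos hR⟩
    · exact Or.inr ⟨hR, if_neg hR⟩
  have hinj : Set.InjOn p (Ico 0 m \ Z : Finset ℤ) := by
    have aux : ∀ i, i + 1 ∉ Z → R i → R (i + 1) := by
      rintro i hi ⟨s, hs, hsi, hz⟩
      refine ⟨s, hs, by omega, fun z hzZ hsz => ?_⟩
      have := hz z hzZ hsz
      have : z ≠ i + 1 := by rintro rfl; exact hi hzZ
      omega
    intro i hi k hk hik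
    rw [mem_coe, mem_sdiff] at hi hk
    rcases hp i with ⟨hR, h1⟩ | ⟨hR, h1⟩ <;> rcases hp k with ⟨hR', h2⟩ | ⟨hR', h2⟩
    · omega
    · have : k = i + 1 := by omega
      subst this
      exact absurd (aux i hk.2 hR) hR'
    · have : i = k + 1 := by omega
      subst this
      exact absurd (aux k hi.2 hR') hR
    · omega
  have hmaps : ∀ i ∈ Ico 0 m \ Z, p i ∈ Ico 0 (m + 1) \ S := by
    intro i hi
    rw [mem_sdiff, mem_Ico] at hi
    rw [mem_sdiff, mem_Ico]
    refine ⟨by rcases hp i with h | h <;> omega, fun hpS => ?_⟩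
    rcases hp i with ⟨⟨s, hs, hsi, hz⟩, h1⟩ | ⟨hR, h1⟩
    · rw [h1] at hpS
      obtain ⟨z, hzZ, hsz, hzi⟩ := h s hs _ hpS (by omega)
      have := hz z hzZ hsz
      omega
    · rw [h1] at hpS
      refine hR ⟨i, hpS, le_rfl, fun z hzZ hiz => lt_of_le_of_ne hiz ?_⟩
      rintro rfl
      exact hi.2 hzZ
  -- Injectivity suffices: both sides have m - |Z| = m + 1 - |S| elements.
  have himg : (Ico 0 m \ Z).image p = Ico 0 (m + 1) \ S := by
    refine eq_of_subset_of_card_le (image_subset_iff.2 hmaps) ?_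
    rw [card_image_of_injOn hinj, card_sdiff_of_subset hS, card_sdiff_of_subset hZ, Int.card_Ico,
      Int.card_Ico]
    have h1 := card_le_card hZ
    rw [Int.card_Ico] at h1
    omega
  refine ⟨(Ico 0 m \ Z).image fun i => {down i (j + 1), up (p i) j}, ?_, ?_, ?_⟩
  · intro L hL
    obtain ⟨i, -, rfl⟩ := mem_image.1 hL
    rw [isLozenge_down_iff]
    rcases hp i with h | h <;> rw [h.2] <;> simp
  · intro L hL L' hL' hne
    obtain ⟨i, hi, rfl⟩ := mem_image.1 hL
    obtain ⟨k, hk, rfl⟩ := mem_image.1 hL'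
    have hik : i ≠ k := by rintro rfl; exact hne rfl
    rw [disjoint_left]
    intro x hx hx'
    simp only [mem_insert, mem_singleton] at hx hx'
    rcases hx with rfl | rfl
    · simp [hik] at hx'
    · simp only [reduceCtorEq, up.injEq, and_true, false_or] at hx'
      exact hik (hinj hi hk hx')
  · rw [strip, ← himg]
    ext x
    simp only [mem_biUnion, mem_image, id, mem_union]
    constructor
    · rintro ⟨_, ⟨i, hi, rfl⟩, hx⟩
      simp only [mem_insert, mem_singleton] at hx
      rcases hx with rfl | rfl
      · exact Or.inr ⟨i, hi, rfl⟩
      · exact Or.inl ⟨_, ⟨i, hi, rfl⟩, rfl⟩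
    · rintro (⟨_, ⟨i, hi, rfl⟩, rfl⟩ | ⟨i, hi, rfl⟩) <;> exact ⟨_, ⟨i, hi, rfl⟩, by simp⟩

/-- The sets `S` and `Z` of dents on the two sides of a strip interlace. -/
def Interlace (S Z : Finset ℤ) : Prop :=
  Z.card + 1 = S.card ∧ ∀ s ∈ S, ∀ t ∈ S, s < t → ∃ z ∈ Z, s ≤ z ∧ z < t

open Classical in
theorem M_strip {j m : ℤ} (hm : 0 ≤ m) {S Z : Finset ℤ}
    (hS : S ⊆ Ico 0 (m + 1)) (hZ : Z ⊆ Ico 0 m) :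
    M (strip j m S Z) = if Interlace S Z then 1 else 0 := by
  split_ifs with h
  · obtain ⟨T, hT⟩ := exists_strip_tiling (j := j) hS hZ h.1 h.2
    rw [M, card_eq_one]
    refine ⟨T, ?_⟩
    ext T'
    rw [mem_lozengeTilings, mem_singleton]
    constructor
    · intro hT'
      exact (strip_tiling_unique hT' hT).antisymm (strip_tiling_unique hT hT')
    · rintro rfl
      exact hT
  · rw [M, card_eq_zero, eq_empty_iff_forall_notMem]
    intro T hT
    exact h (interlace_of_isLozengeTiling hm hS hZ (mem_lozengeTilings.1 hT))

/-! ### Summing Vandermonde determinants over interlacing sequences. -/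

/-- Falling factorials serve as the polynomial basis because their discrete derivatives, and so
their sums over intervals, are again multiples of falling factorials. -/
theorem descPochhammer_eval_add_one_sub (n : ℕ) (x : ℚ) :
    (descPochhammer ℚ (n + 1)).eval (x + 1) - (descPochhammer ℚ (n + 1)).eval x =
      (n + 1) * (descPochhammer ℚ n).eval x := by
  rw [descPochhammer_succ_left, Polynomial.eval_mul, Polynomial.eval_comp,
    ← descPochhammer_succ_left, descPochhammer_succ_eval]
  simp
  ring

theorem sum_Ico_descPochhammer_eval (n : ℕ) {s t : ℤ} (h : s ≤ t) :
    ∑ x ∈ Ico s t, (descPochhammer ℚ n).eval (x : ℚ) =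
      ((descPochhammer ℚ (n + 1)).eval (t : ℚ) - (descPochhammer ℚ (n + 1)).eval (s : ℚ)) /
        (n + 1) := by
  have hn : (n + 1 : ℚ) ≠ 0 := by positivity
  induction t, h using Int.leInduction with
  | base => simp
  | succ t hst ih =>
    have : Ico s (t + 1) = insert t (Ico s t) := by
      ext x; simp only [mem_Ico, mem_insert]; omega
    rw [this, sum_insert (by simp), ih]
    have := descPochhammer_eval_add_one_sub n (t : ℚ)
    push_cast
    field_simp
    linarith

/-- Replacing the powers by monic polynomials of the same degrees is a unitriangular column
operation. -/
theorem det_vandermonde_eq_det_descPochhammer {n : ℕ} (v : Fin n → ℚ) :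
    (Matrix.vandermonde v).det =
      (Matrix.of fun i j : Fin n => (descPochhammer ℚ j).eval (v i)).det :=
  Matrix.det_eval_matrixOfPolynomials_eq_det_vandermonde v (fun j => descPochhammer ℚ j)
    (fun _ => descPochhammer_natDegree _ _) (fun _ => monic_descPochhammer _ _)

/-- The sum of the Vandermonde determinants over all sequences that interlace a given one. -/
theorem sum_piFinset_det_vandermonde {n : ℕ} (s : Fin (n + 1) → ℤ) (hs : Monotone s) :
    ∑ r ∈ Fintype.piFinset fun i : Fin n => Ico (s i.castSucc) (s i.succ),
      (Matrix.vandermonde fun i => (r i : ℚ)).det =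
      (Matrix.vandermonde fun i => (s i : ℚ)).det / n.factorial := by
  -- Row i depends on `r i` only, so by multilinearity the sum moves into the rows.
  have h1 : ∑ r ∈ Fintype.piFinset fun i : Fin n => Ico (s i.castSucc) (s i.succ),
      (Matrix.vandermonde fun i => (r i : ℚ)).det =
      (Matrix.of fun i j : Fin n =>
        ∑ x ∈ Ico (s i.castSucc) (s i.succ), (descPochhammer ℚ j).eval (x : ℚ)).det := by
    have := (Matrix.detRowAlternating (n := Fin n) (R := ℚ)).toMultilinearMap.map_sum_finset
      (fun (_ : Fin n) (x : ℤ) (j : Fin n) => (descPochhammer ℚ j).eval (x : ℚ))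
      (fun i : Fin n => Ico (s i.castSucc) (s i.succ))
    simp only [det_vandermonde_eq_det_descPochhammer]
    refine Eq.trans this.symm (congrArg Matrix.det ?_)
    ext i j
    simp
  have h2 : (Matrix.of fun i j : Fin n =>
      ∑ x ∈ Ico (s i.castSucc) (s i.succ), (descPochhammer ℚ j).eval (x : ℚ)).det =
      (∏ j : Fin n, ((j : ℚ) + 1)⁻¹) * (Matrix.of fun i j : Fin n =>
        (descPochhammer ℚ (j + 1)).eval (s i.succ : ℚ) -
          (descPochhammer ℚ (j + 1)).eval (s i.castSucc : ℚ)).det := by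
    rw [← Matrix.det_mul_row]
    congr 1
    ext i j
    simp only [Matrix.of_apply]
    rw [sum_Ico_descPochhammer_eval _ (hs (Fin.castSucc_lt_succ).le), div_eq_inv_mul]
  -- Subtract from each row its predecessor. The first column, constantly 1, becomes (1, 0, …, 0),
  -- and expansion along it leaves the matrix of differences.
  have h3 : (Matrix.vandermonde fun i => (s i : ℚ)).det = (Matrix.of fun i j : Fin n =>
        (descPochhammer ℚ (j + 1)).eval (s i.succ : ℚ) -
          (descPochhammer ℚ (j + 1)).eval (s i.castSucc : ℚ)).det := by
    rw [det_vandermonde_eq_det_descPochhammer]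
    rw [Matrix.det_eq_of_forall_row_eq_smul_add_pred (B := Matrix.of (Fin.cons
      (fun j : Fin (n + 1) => (descPochhammer ℚ j).eval (s 0 : ℚ))
      fun (i : Fin n) (j : Fin (n + 1)) => (descPochhammer ℚ j).eval (s i.succ : ℚ) -
          (descPochhammer ℚ j).eval (s i.castSucc : ℚ))) (fun _ => 1) (by simp) (by simp),
      Matrix.det_succ_column_zero, Fin.sum_univ_succ]
    simp [Matrix.submatrix]
  have h4 : ∏ j : Fin n, ((j : ℚ) + 1)⁻¹ = (n.factorial : ℚ)⁻¹ := by
    rw [Fin.prod_univ_eq_prod_range (fun j => ((j : ℚ) + 1)⁻¹), prod_inv_distrib,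
      ← prod_range_add_one_eq_factorial]
    push_cast
    rfl
  rw [h1, h2, h3, h4, div_eq_inv_mul]

/-! ### Difference products of finite sets. -/

/-- The product of the differences of a finite set of integers. -/
def vdm (S : Finset ℤ) : ℚ :=
  ∏ p ∈ (S ×ˢ S).filter (fun p => p.1 < p.2), ((p.2 : ℚ) - p.1)

/-- Increasing order makes every factor of the determinant a larger minus a smaller element, so no
sign appears. -/
theorem vdm_image {n : ℕ} {s : Fin n → ℤ} (hs : StrictMono s) :
    vdm (univ.image s) = (Matrix.vandermonde fun i => (s i : ℚ)).det := by
  rw [Matrix.det_vandermonde, prod_sigma', vdm]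
  refine (prod_nbij (fun x : (_ : Fin n) × Fin n => (s x.1, s x.2)) ?_ ?_ ?_ ?_).symm
  · rintro ⟨i, j⟩ h
    simp only [mem_sigma, mem_univ, mem_Ioi, true_and] at h
    simp [hs h]
  · rintro ⟨i, j⟩ - ⟨i', j'⟩ - h
    simp only [Prod.mk.injEq] at h
    obtain rfl := hs.injective h.1
    obtain rfl := hs.injective h.2
    rfl
  · rintro ⟨x, y⟩ h
    simp only [coe_filter, mem_product, mem_image, mem_univ, true_and, Set.mem_ofPred_eq] at h
    obtain ⟨⟨⟨i, rfl⟩, j, rfl⟩, h⟩ := h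
    exact ⟨⟨i, j⟩, by simpa using hs.lt_iff_lt.1 h, rfl⟩
  · simp

theorem vdm_pos (S : Finset ℤ) : 0 < vdm S := by
  refine prod_pos fun p hp => ?_
  have := (mem_filter.1 hp).2
  rw [sub_pos]
  exact_mod_cast this

/-- The product of the distances between the elements of two sets. -/
def cross (S Z : Finset ℤ) : ℚ := ∏ x ∈ S, ∏ z ∈ Z, |(x : ℚ) - z|

theorem vdm_insert {S : Finset ℤ} {z : ℤ} (hz : z ∉ S) :
    vdm (insert z S) = vdm S * ∏ x ∈ S, |(x : ℚ) - z| := by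
  have h1 : ((insert z S ×ˢ insert z S).filter fun p => p.1 < p.2) =
      ((S ×ˢ S).filter fun p => p.1 < p.2) ∪
        S.image (fun x => if x < z then (x, z) else (z, x)) := by
    ext ⟨x, y⟩
    simp only [mem_filter, mem_product, mem_insert, mem_union, mem_image]
    constructor
    · rintro ⟨⟨rfl | hx, rfl | hy⟩, h⟩
      · exact absurd h (lt_irrefl _)
      · exact Or.inr ⟨y, hy, if_neg (by omega)⟩
      · exact Or.inr ⟨x, hx, if_pos h⟩
      · exact Or.inl ⟨⟨hx, hy⟩, h⟩
    · rintro (⟨⟨hx, hy⟩, h⟩ | ⟨w, hw, h⟩)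
      · tauto
      · have hwz : w ≠ z := by rintro rfl; exact hz hw
        split_ifs at h with hlt
        · simp only [Prod.mk.injEq] at h
          obtain ⟨rfl, rfl⟩ := h
          tauto
        · simp only [Prod.mk.injEq] at h
          obtain ⟨rfl, rfl⟩ := h
          refine ⟨by tauto, by omega⟩
  rw [vdm, vdm, h1, prod_union, prod_image]
  · congr 1
    refine prod_congr rfl fun x hx => ?_
    split_ifs with h
    · have : (x : ℚ) < z := by exact_mod_cast h
      rw [abs_of_neg (by linarith)]
      ring
    · have : (z : ℚ) ≤ x := by exact_mod_cast not_lt.1 h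
      rw [abs_of_nonneg (by linarith)]
  · intro x hx y hy h
    have hxz : x ≠ z := by rintro rfl; exact hz hx
    have hyz : y ≠ z := by rintro rfl; exact hz hy
    dsimp only at h
    split_ifs at h <;> simp only [Prod.mk.injEq] at h <;> omega
  · rw [disjoint_left]
    rintro ⟨x, y⟩ h h'
    simp only [mem_filter, mem_product, mem_image] at h h'
    obtain ⟨w, hw, h'⟩ := h'
    split_ifs at h' <;> simp only [Prod.mk.injEq] at h'
    · exact hz (h'.2 ▸ h.1.2)
    · exact hz (h'.1 ▸ h.1.1)

/-- Separates the fixed dents from the variable positions on ℓ. The absolute values in `cross` make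
the order of the elements of the two sets irrelevant. -/
theorem vdm_union {S Z : Finset ℤ} (h : Disjoint S Z) :
    vdm (S ∪ Z) = vdm S * vdm Z * cross S Z := by
  induction Z using Finset.induction_on with
  | empty => simp [vdm, cross]
  | insert z Z hz ih =>
    rw [disjoint_insert_right] at h
    rw [union_insert, vdm_insert (by simp [h.1, hz]), ih h.2, vdm_insert hz, prod_union h.2]
    simp only [cross, prod_insert hz, prod_mul_distrib]
    ring

theorem strictMono_of_mem_piFinset_Ico {n : ℕ} {s : Fin (n + 1) → ℤ} (hs : Monotone s)
    {r : Fin n → ℤ} (hr : r ∈ Fintype.piFinset fun i : Fin n => Ico (s i.castSucc) (s i.succ)) :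
    StrictMono r := by
  intro i k hik
  rw [Fintype.mem_piFinset] at hr
  have h1 := (mem_Ico.1 (hr i)).2
  have h2 := (mem_Ico.1 (hr k)).1
  have h3 : s i.succ ≤ s k.castSucc := hs (by
    rw [Fin.le_def]; simpa using hik)
  omega

/-- Interlacing sets as sets of values of interlacing sequences. -/
theorem exists_of_interlace {n : ℕ} {s : Fin (n + 1) → ℤ} (hs : StrictMono s) {Z : Finset ℤ} :
    Interlace (univ.image s) Z ↔
      ∃ r ∈ Fintype.piFinset fun i : Fin n => Ico (s i.castSucc) (s i.succ), univ.image r = Z := by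
  have hmono := fun r => strictMono_of_mem_piFinset_Ico hs.monotone (r := r)
  have hS : (univ.image s).card = n + 1 := by
    rw [card_image_of_injective _ hs.injective, card_univ, Fintype.card_fin]
  constructor
  · rintro ⟨hc, h⟩
    have : ∀ i : Fin n, ∃ z ∈ Z, s i.castSucc ≤ z ∧ z < s i.succ := fun i =>
      h _ (mem_image_of_mem s (mem_univ _)) _ (mem_image_of_mem s (mem_univ _))
        (hs Fin.castSucc_lt_succ)
    choose r hrZ hr using this
    have hr' : r ∈ Fintype.piFinset fun i : Fin n => Ico (s i.castSucc) (s i.succ) :=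
      Fintype.mem_piFinset.2 fun i => mem_Ico.2 (hr i)
    -- One element in each of the n disjoint gaps already exhausts Z.
    refine ⟨r, hr', eq_of_subset_of_card_le (image_subset_iff.2 fun i _ => hrZ i) ?_⟩
    rw [card_image_of_injective _ (hmono r hr').injective, card_univ, Fintype.card_fin]
    omega
  · rintro ⟨r, hr, rfl⟩
    refine ⟨?_, ?_⟩
    · rw [hS, card_image_of_injective _ (hmono r hr).injective, card_univ, Fintype.card_fin]
    · intro x hx y hy hxy
      obtain ⟨i, -, rfl⟩ := mem_image.1 hx
      obtain ⟨k, -, rfl⟩ := mem_image.1 hy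
      have hik := hs.lt_iff_lt.1 hxy
      obtain ⟨i, rfl⟩ := Fin.exists_castSucc_eq.2 (Fin.ne_last_of_lt hik)
      rw [Fintype.mem_piFinset] at hr
      have h1 := mem_Ico.1 (hr i)
      exact ⟨r i, mem_image_of_mem r (mem_univ _), h1.1,
        h1.2.trans_le (hs.monotone (Fin.castSucc_lt_iff_succ_le.1 hik))⟩

open Classical in
/-- Summation of `vdm` over the sets that interlace a given one. -/
theorem sum_vdm_interlace {n : ℕ} {m : ℤ} {S : Finset ℤ} (hS : S ⊆ Ico 0 (m + 1))
    (hn : S.card = n + 1) :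
    ∑ Z ∈ (Ico 0 m).powerset with Interlace S Z, vdm Z = vdm S / n.factorial := by
  obtain ⟨s, hs, hSs⟩ : ∃ s : Fin (n + 1) → ℤ, StrictMono s ∧ univ.image s = S :=
    ⟨_, (S.orderEmbOfFin hn).strictMono, Finset.image_orderEmbOfFin_univ _ _⟩
  rw [← hSs, vdm_image hs, ← sum_piFinset_det_vandermonde s hs.monotone]
  have hmono := fun r => strictMono_of_mem_piFinset_Ico hs.monotone (r := r)
  symm
  refine sum_nbij (fun r => univ.image r) ?_ ?_ ?_ ?_
  · intro r hr
    rw [mem_filter, mem_powerset, exists_of_interlace hs]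
    refine ⟨?_, r, hr, rfl⟩
    intro x hx
    obtain ⟨i, -, rfl⟩ := mem_image.1 hx
    rw [Fintype.mem_piFinset] at hr
    have h1 := mem_Ico.1 (hr i)
    have h2 := mem_Ico.1 (hS (hSs ▸ mem_image_of_mem s (mem_univ i.castSucc)))
    have h3 := mem_Ico.1 (hS (hSs ▸ mem_image_of_mem s (mem_univ i.succ)))
    rw [mem_Ico]
    omega
  · intro r hr r' hr' h
    have := (hmono r hr).range_inj (hmono r' hr')
    apply this.1
    have h := congrArg (fun S : Finset ℤ => (S : Set ℤ)) h
    simpa using h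
  · intro Z hZ
    rw [mem_coe, mem_filter, exists_of_interlace hs] at hZ
    obtain ⟨r, hr, h⟩ := hZ.2
    exact ⟨r, hr, h⟩
  · intro r hr
    exact (vdm_image (hmono r hr)).symm

/-! ### Horizontal cuts and dented trapezoids. -/

/-- Whether a unit triangle lies above the horizontal lattice line at height `l`. -/
def UnitTriangle.Above (l : ℤ) : UnitTriangle → Prop
  | .up _ j => l ≤ j
  | .down _ j => l < j

instance (l : ℤ) : DecidablePred (UnitTriangle.Above l) := fun t => by
  cases t <;> unfold UnitTriangle.Above <;> infer_instance

@[simp]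
theorem above_up {l i j : ℤ} : (up i j).Above l ↔ l ≤ j := Iff.rfl

@[simp]
theorem above_down {l i j : ℤ} : (down i j).Above l ↔ l < j := Iff.rfl

/-- Cutting a region along a horizontal lattice line. -/
theorem M_eq_sum_horizontal_cut (l : ℤ) (G : Finset UnitTriangle) (I : Finset ℤ)
    (hI : ∀ z, z ∈ I ↔ up z l ∈ G ∧ down z l ∈ G) :
    M G = ∑ Z ∈ I.powerset, M (G.filter (Above l) \ Z.image (up · l)) *
      M (G.filter (fun t => ¬ t.Above l) \ Z.image (down · l)) := by
  refine M_eq_sum_cut (p := Above l) (u := (up · l)) (d := (down · l)) (by simp) (by simp)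
    (fun i k h => by simpa using h) (fun i k h => by simpa using h) ?_ ?_ G I hI
  · intro z
    rw [pair_comm, isLozenge_down_iff]
    exact Or.inl rfl
  · intro L hL
    obtain ⟨i, j, h⟩ := isLozenge_iff.1 hL
    rcases lt_trichotomy l j with hl | rfl | hl
    · left
      rcases h with rfl | rfl | rfl <;> simp [hl, hl.le]
    -- Only the vertical lozenge crosses the line; the other two containing `down i l` lie below it.
    · rcases h with rfl | rfl | rfl
      · exact Or.inr (Or.inr ⟨i, pair_comm _ _⟩)
      · simp
      · simp
    · right; left
      rcases h with rfl | rfl | rfl <;> simp <;> omega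

/-- The trapezoid between the lines at heights `j` and `b` inside the triangle with sides given by
`0 ≤ i`, `i + j ≤ N`. -/
noncomputable def trapezoid (N j b : ℤ) : Finset UnitTriangle :=
  ((Ico 0 (N - j) ×ˢ Ico j b).filter fun p => p.1 + p.2 < N).image (fun p => up p.1 p.2) ∪
    ((Ico 0 (N - j) ×ˢ Ioc j b).filter fun p => p.1 + p.2 < N).image (fun p => down p.1 p.2)

theorem up_mem_trapezoid {N j b i k : ℤ} :
    up i k ∈ trapezoid N j b ↔ 0 ≤ i ∧ i + k < N ∧ j ≤ k ∧ k < b := by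
  simp only [trapezoid, mem_union, mem_image, mem_filter, mem_product, mem_Ico, up.injEq,
    reduceCtorEq, and_false, exists_false, or_false, Prod.exists]
  constructor
  · rintro ⟨x, y, h, rfl, rfl⟩
    omega
  · intro h
    exact ⟨i, k, by omega, rfl, rfl⟩

theorem down_mem_trapezoid {N j b i k : ℤ} :
    down i k ∈ trapezoid N j b ↔ 0 ≤ i ∧ i + k < N ∧ j < k ∧ k ≤ b := by
  simp only [trapezoid, mem_union, mem_image, mem_filter, mem_product, mem_Ico, mem_Ioc, down.injEq,
    reduceCtorEq, and_false, exists_false, false_or, Prod.exists]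
  constructor
  · rintro ⟨x, y, h, rfl, rfl⟩
    omega
  · intro h
    exact ⟨i, k, by omega, rfl, rfl⟩

theorem up_mem_image {S : Finset ℤ} {i j l : ℤ} :
    up i j ∈ S.image (up · l) ↔ i ∈ S ∧ j = l := by
  simp only [mem_image, up.injEq]
  constructor
  · rintro ⟨x, hx, rfl, rfl⟩
    exact ⟨hx, rfl⟩
  · rintro ⟨h, rfl⟩
    exact ⟨i, h, rfl, rfl⟩

theorem down_mem_image {S : Finset ℤ} {i j l : ℤ} :
    down i j ∈ S.image (down · l) ↔ i ∈ S ∧ j = l := by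
  simp only [mem_image, down.injEq]
  constructor
  · rintro ⟨x, hx, rfl, rfl⟩
    exact ⟨hx, rfl⟩
  · rintro ⟨h, rfl⟩
    exact ⟨i, h, rfl, rfl⟩

theorem H_succ (n : ℕ) : H (n + 1) = H n * n.factorial := prod_range_succ _ _

theorem H_pos (n : ℕ) : 0 < H n := prod_pos fun i _ => by exact_mod_cast i.factorial_pos

theorem M_empty : M ∅ = 1 := by
  rw [M, card_eq_one]
  refine ⟨∅, ?_⟩
  ext T
  rw [mem_lozengeTilings, mem_singleton]
  constructor
  · intro hT
    rw [eq_empty_iff_forall_notMem]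
    intro L hL
    obtain ⟨x, hx⟩ := (hT.1 L hL).nonempty
    exact absurd (hT.subset hL hx) (notMem_empty x)
  · rintro rfl
    exact ⟨by simp, by simp, by simp⟩

/-- The number of lozenge tilings of a trapezoid with dents along its base (Cohn, Larsen and
Propp). -/
theorem M_trapezoid (N : ℤ) (n : ℕ) : ∀ (j : ℤ), j + n ≤ N → ∀ S ⊆ Ico 0 (N - j),
    (n = 0 → S = ∅) → (M (trapezoid N j (j + n) \ S.image (up · j)) : ℚ) * H n =
      if S.card = n then vdm S else 0 := by
  classical
  induction n with
  | zero =>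
    -- At height zero the region is empty whatever S is, so the count 1 matches the formula only for
    -- empty S.
    intro j hj S hS hS0
    obtain rfl := hS0 rfl
    have : trapezoid N j (j + (0 : ℕ)) = ∅ := by
      rw [eq_empty_iff_forall_notMem]
      rintro (⟨i, k⟩ | ⟨i, k⟩) h
      · rw [up_mem_trapezoid] at h; omega
      · rw [down_mem_trapezoid] at h; omega
    rw [this]
    simp [M_empty, H, vdm]
  | succ n ih =>
    intro j hj S hS _
    push_cast at hj ⊢
    -- The bottom row is cut off. For n = 0 nothing lies above it, so no lozenge can cross the cut.
    set I : Finset ℤ := if n = 0 then ∅ else Ico 0 (N - j - 1) with hI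
    have hIsub : I ⊆ Ico 0 (N - j - 1) := by
      rw [hI]; split_ifs <;> simp
    rw [M_eq_sum_horizontal_cut (j + 1) _ I]
    · have hterm : ∀ Z ∈ I.powerset,
          (M ((trapezoid N j (j + (n + 1)) \ S.image (up · j)).filter (Above (j + 1)) \
            Z.image (up · (j + 1))) : ℚ) *
          (M ((trapezoid N j (j + (n + 1)) \ S.image (up · j)).filter (fun t => ¬ t.Above (j + 1)) \
            Z.image (down · (j + 1))) : ℚ) * H n =
          if S.card = n + 1 then if Interlace S Z then vdm Z else 0 else 0 := by
        intro Z hZ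
        rw [mem_powerset] at hZ
        have e1 : (trapezoid N j (j + (n + 1)) \ S.image (up · j)).filter (Above (j + 1)) \
            Z.image (up · (j + 1)) =
            trapezoid N (j + 1) (j + 1 + n) \ Z.image (up · (j + 1)) := by
          ext (⟨i, k⟩ | ⟨i, k⟩)
          · simp only [mem_sdiff, mem_filter, up_mem_trapezoid, up_mem_image, above_up]
            grind
          · simp only [mem_sdiff, mem_filter, down_mem_trapezoid, above_down, mem_image,
              reduceCtorEq, and_false, exists_false, not_false_eq_true]
            grind
        have e2 : (trapezoid N j (j + (n + 1)) \ S.image (up · j)).filter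
            (fun t => ¬ t.Above (j + 1)) \ Z.image (down · (j + 1)) =
            strip j (N - j - 1) S Z := by
          ext (⟨i, k⟩ | ⟨i, k⟩)
          · simp only [mem_sdiff, mem_filter, up_mem_trapezoid, above_up, up_mem_strip,
              mem_image, reduceCtorEq, and_false, exists_false, not_false_eq_true]
            grind
          · simp only [mem_sdiff, mem_filter, down_mem_trapezoid, above_down, mem_image,
              down_mem_strip, reduceCtorEq, and_false, exists_false, not_false_eq_true,
              down.injEq]
            grind
        rw [e1, e2, mul_right_comm, ih (j + 1) (by omega) Z
          (hZ.trans (hIsub.trans (by rw [sub_sub]))) (fun h => by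
            rw [hI, if_pos h] at hZ; exact subset_empty.1 hZ),
          M_strip (by omega) (by rwa [sub_add_cancel]) (hZ.trans hIsub)]
        by_cases hint : Interlace S Z
        · have := hint.1
          by_cases hc : S.card = n + 1
          · rw [if_pos (by omega), if_pos hint, if_pos hc, if_pos hint]; simp
          · rw [if_neg (by omega), if_neg hc]; simp
        · simp [hint]
      rw [Nat.cast_sum, H_succ, ← mul_assoc, sum_mul]
      simp only [Nat.cast_mul]
      rw [sum_congr rfl hterm]
      split_ifs with hc
      · rw [← sum_filter]
        have : I.powerset.filter (Interlace S) =
            (Ico 0 (N - j - 1)).powerset.filter (Interlace S) := by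
          ext Z
          simp only [mem_filter, mem_powerset, and_congr_left_iff]
          refine fun hint => ⟨fun h => h.trans hIsub, fun h => ?_⟩
          by_cases hn : n = 0
          · have := hint.1
            have hZ : Z = ∅ := by rw [← card_eq_zero]; omega
            rw [hZ]; exact empty_subset _
          · rwa [hI, if_neg hn]
        -- The denominator n! of the interlacing sum is the new factor of H(n + 1).
        rw [this, sum_vdm_interlace (n := n) (by rwa [sub_add_cancel]) hc,
          div_mul_cancel₀ _ (by exact_mod_cast n.factorial_ne_zero)]
      · simp
    · intro z
      simp only [mem_sdiff, up_mem_trapezoid, down_mem_trapezoid, mem_image,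
        reduceCtorEq, and_false, exists_false, not_false_eq_true, hI]
      split_ifs with h
      · simp only [notMem_empty, false_iff]; omega
      · rw [mem_Ico]; grind

/-! ### The two halves of the dented hexagon. -/

/-- The reflection of the triangular lattice in the line at height `0`. -/
def reflect : UnitTriangle ≃ UnitTriangle where
  toFun
    | .up i j => .down (i + j) (-j)
    | .down i j => .up (i + j) (-j)
  invFun
    | .up i j => .down (i + j) (-j)
    | .down i j => .up (i + j) (-j)
  left_inv t := by cases t <;> simp
  right_inv t := by cases t <;> simp

@[simp]
theorem reflect_up (i j : ℤ) : reflect (up i j) = down (i + j) (-j) := rfl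

@[simp]
theorem reflect_down (i j : ℤ) : reflect (down i j) = up (i + j) (-j) := rfl

theorem IsLozenge.image_reflect {L : Finset UnitTriangle} (hL : IsLozenge L) :
    IsLozenge (L.image reflect) := by
  obtain ⟨i, j, rfl | rfl | rfl⟩ := isLozenge_iff.1 hL <;>
    rw [image_insert, image_singleton, reflect_up, reflect_down, pair_comm, isLozenge_down_iff]
  · exact Or.inl rfl
  · refine Or.inr (Or.inr ?_)
    congr 1 <;> ring
  · refine Or.inr (Or.inl ?_)
    congr 1 <;> ring

theorem M_image_reflect (G : Finset UnitTriangle) : M (G.image reflect) = M G :=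
  M_image reflect (fun _ h => h.image_reflect) (fun _ h => h.image_reflect) G

theorem mem_image_reflect {G : Finset UnitTriangle} {t : UnitTriangle} :
    t ∈ G.image reflect ↔ reflect t ∈ G := by
  rw [mem_image]
  constructor
  · rintro ⟨x, hx, rfl⟩
    rwa [show reflect (reflect x) = x from reflect.symm_apply_apply x]
  · intro h
    exact ⟨_, h, reflect.apply_symm_apply t⟩

theorem mem_hexagonPoints {a b c : ℕ} {i j : ℤ} : (i, j) ∈ hexagonPoints a b c ↔
    0 ≤ i ∧ i ≤ a + b ∧ -c ≤ j ∧ j ≤ b ∧ 0 ≤ i + j ∧ i + j ≤ a + b := by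
  simp only [hexagonPoints, mem_filter, mem_product, mem_Icc]
  tauto

theorem up_mem_hexagon {a b c : ℕ} {i j : ℤ} : up i j ∈ hexagon a b c ↔
    0 ≤ i ∧ i < a + b ∧ -c ≤ j ∧ j < b ∧ 0 ≤ i + j ∧ i + j < a + b := by
  rw [hexagon, mem_filter]
  simp only [mem_union, mem_image, up.injEq, reduceCtorEq, and_false,
    exists_false, or_false, vertices, insert_subset_iff, singleton_subset_iff, Prod.exists,
    mem_hexagonPoints]
  constructor
  · rintro ⟨-, h⟩
    omega
  · intro h
    exact ⟨⟨i, j, by omega, rfl, rfl⟩, by omega⟩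

theorem down_mem_hexagon {a b c : ℕ} {i j : ℤ} : down i j ∈ hexagon a b c ↔
    0 ≤ i ∧ i < a + b ∧ -c < j ∧ j ≤ b ∧ 0 ≤ i + j ∧ i + j < a + b := by
  rw [hexagon, mem_filter]
  simp only [mem_union, mem_image, down.injEq, reduceCtorEq, and_false,
    exists_false, false_or, vertices, insert_subset_iff, singleton_subset_iff, Prod.exists,
    mem_hexagonPoints]
  constructor
  · rintro ⟨-, h⟩
    omega
  · intro h
    exact ⟨⟨i, j, by omega, rfl, rfl⟩, by omega⟩

/-- The left end points of the segments with labels in `S` on the horizontal diagonal. -/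
noncomputable def leftEnds (S : Finset ℕ) : Finset ℤ := S.image fun s : ℕ => (s : ℤ) - 1

theorem leftEnds_injective : Function.Injective fun s : ℕ => (s : ℤ) - 1 := by
  intro x y h
  dsimp only at h
  omega

theorem card_leftEnds (S : Finset ℕ) : (leftEnds S).card = S.card :=
  card_image_of_injective _ leftEnds_injective

theorem leftEnds_union (S T : Finset ℕ) : leftEnds (S ∪ T) = leftEnds S ∪ leftEnds T :=
  image_union _ _

theorem leftEnds_inter (S T : Finset ℕ) : leftEnds (S ∩ T) = leftEnds S ∩ leftEnds T :=
  image_inter _ _ leftEnds_injective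

theorem leftEnds_subset {S : Finset ℕ} {n : ℕ} (hS : S ⊆ Icc 1 n) : leftEnds S ⊆ Ico 0 (n : ℤ) := by
  intro x hx
  obtain ⟨s, hs, rfl⟩ := mem_image.1 hx
  have := mem_Icc.1 (hS hs)
  rw [mem_Ico]
  omega

theorem vdm_leftEnds (S : Finset ℕ) : vdm (leftEnds S) = Δ S := by
  rw [vdm, Δ]
  refine (prod_nbij (fun p : ℕ × ℕ => ((p.1 : ℤ) - 1, (p.2 : ℤ) - 1)) ?_ ?_ ?_ ?_).symm
  · rintro ⟨x, y⟩ h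
    simp only [mem_filter, mem_product] at h ⊢
    exact ⟨⟨mem_image_of_mem _ h.1.1, mem_image_of_mem _ h.1.2⟩, by omega⟩
  · rintro ⟨x, y⟩ - ⟨x', y'⟩ - h
    simp only [Prod.mk.injEq] at h ⊢
    omega
  · rintro ⟨x, y⟩ h
    simp only [coe_filter, mem_product, Set.mem_ofPred_eq] at h
    obtain ⟨⟨hx, hy⟩, h⟩ := h
    obtain ⟨s, hs, rfl⟩ := mem_image.1 hx
    obtain ⟨t, ht, rfl⟩ := mem_image.1 hy
    refine ⟨(s, t), ?_, rfl⟩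
    simp only [coe_filter, mem_product, Set.mem_ofPred_eq]
    exact ⟨⟨hs, ht⟩, by omega⟩
  · rintro ⟨x, y⟩ -
    push_cast
    ring

theorem dentedHexagon_eq (a b c : ℕ) (X Y : Finset ℕ) : dentedHexagon a b c X Y =
    hexagon a b c \ ((leftEnds X).image (up · 0) ∪ (leftEnds Y).image (down · 0)) := by
  rw [dentedHexagon, leftEnds, leftEnds, image_image, image_image]
  rfl

theorem up_mem_dentedHexagon {a b c : ℕ} {X Y : Finset ℕ} {i j : ℤ} :
    up i j ∈ dentedHexagon a b c X Y ↔
      (0 ≤ i ∧ i < a + b ∧ -c ≤ j ∧ j < b ∧ 0 ≤ i + j ∧ i + j < a + b) ∧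
        ¬ (i ∈ leftEnds X ∧ j = 0) := by
  rw [dentedHexagon_eq, mem_sdiff, mem_union, up_mem_image, up_mem_hexagon]
  simp

theorem down_mem_dentedHexagon {a b c : ℕ} {X Y : Finset ℕ} {i j : ℤ} :
    down i j ∈ dentedHexagon a b c X Y ↔
      (0 ≤ i ∧ i < a + b ∧ -c < j ∧ j ≤ b ∧ 0 ≤ i + j ∧ i + j < a + b) ∧
        ¬ (i ∈ leftEnds Y ∧ j = 0) := by
  rw [dentedHexagon_eq, mem_sdiff, mem_union, down_mem_image, down_mem_hexagon]
  simp

/-- Half of a dented hexagon is a trapezoid with dents along its base. -/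
theorem dentedHexagon_upper (a b c : ℕ) (X Y : Finset ℕ) (Z : Finset ℤ) :
    (dentedHexagon a b c X Y).filter (Above 0) \ Z.image (up · 0) =
      trapezoid (a + b) 0 (0 + b) \ (leftEnds X ∪ Z).image (up · 0) := by
  ext (⟨i, k⟩ | ⟨i, k⟩)
  · simp only [mem_sdiff, mem_filter, up_mem_trapezoid, up_mem_image, above_up, mem_union,
      up_mem_dentedHexagon]
    grind
  · simp only [mem_sdiff, mem_filter, down_mem_trapezoid, above_down, mem_image,
      reduceCtorEq, and_false, exists_false, not_false_eq_true, down_mem_dentedHexagon]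
    grind

/-- Reflection in ℓ turns down-pointing dents into up-pointing ones, so the lower half is covered by
the same trapezoid formula, with c and Y for b and X. -/
theorem dentedHexagon_lower (a b c : ℕ) (X Y : Finset ℕ) (Z : Finset ℤ) :
    ((dentedHexagon a b c X Y).filter (fun t => ¬ t.Above 0) \ Z.image (down · 0)).image reflect =
      trapezoid (a + b) 0 (0 + c) \ (leftEnds Y ∪ Z).image (up · 0) := by
  ext (⟨i, k⟩ | ⟨i, k⟩)
  · simp only [mem_image_reflect, reflect_up, mem_sdiff, mem_filter, up_mem_trapezoid, up_mem_image,
      above_down, mem_union, down_mem_dentedHexagon, down_mem_image]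
    by_cases hk : k = 0
    · subst hk
      simp only [add_zero, neg_zero]
      grind
    · grind
  · rw [mem_image_reflect]
    simp only [reflect_down, mem_sdiff, mem_filter, down_mem_trapezoid, above_up,
      mem_image, reduceCtorEq, and_false, exists_false, not_false_eq_true, up_mem_dentedHexagon]
    grind

/-- Z is the set of places where vertical lozenges cross ℓ. A half has tilings only if it has as
many dents as its height, which forces |Z| = k on both sides at once. -/
theorem M_dentedHexagon {a b c k : ℕ} {X Y : Finset ℕ} (hX : X ⊆ Icc 1 (a + b))
    (hY : Y ⊆ Icc 1 (a + b)) (hc : c ≤ a + b) (hbX : X.card + k = b) (hcY : Y.card + k = c) :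
    (M (dentedHexagon a b c X Y) : ℚ) * (H b * H c) =
      ∑ Z ∈ (Ico (0 : ℤ) (a + b : ℕ) \ leftEnds (X ∪ Y)).powersetCard k,
        vdm (leftEnds X ∪ Z) * vdm (leftEnds Y ∪ Z) := by
  set J := Ico (0 : ℤ) (a + b : ℕ) \ leftEnds (X ∪ Y) with hJ
  -- If a half has height zero, no lozenge crosses ℓ. Then k = 0 as well, and the sum has the single
  -- term Z = ∅ in either description.
  set I : Finset ℤ := if b = 0 ∨ c = 0 then ∅ else J with hI
  have hIJ : I ⊆ J := by
    rw [hI]; split_ifs <;> simp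
  have hXI := leftEnds_subset hX
  have hYI := leftEnds_subset hY
  rw [M_eq_sum_horizontal_cut 0 _ I]
  · have hterm : ∀ Z ∈ I.powerset,
        (M ((dentedHexagon a b c X Y).filter (Above 0) \ Z.image (up · 0)) : ℚ) *
        (M ((dentedHexagon a b c X Y).filter (fun t => ¬ t.Above 0) \ Z.image (down · 0)) : ℚ) *
          (H b * H c) = if Z.card = k then vdm (leftEnds X ∪ Z) * vdm (leftEnds Y ∪ Z) else 0 := by
      intro Z hZ
      rw [mem_powerset] at hZ
      have hZJ := hZ.trans hIJ
      have hdX : Disjoint (leftEnds X) Z := disjoint_left.2 fun x hx hx' =>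
        (mem_sdiff.1 (hZJ hx')).2 (by rw [leftEnds_union]; exact mem_union_left _ hx)
      have hdY : Disjoint (leftEnds Y) Z := disjoint_left.2 fun x hx hx' =>
        (mem_sdiff.1 (hZJ hx')).2 (by rw [leftEnds_union]; exact mem_union_right _ hx)
      have hZN : Z ⊆ Ico (0 : ℤ) (a + b : ℕ) := hZJ.trans sdiff_subset
      have hempty : ∀ (W : Finset ℕ) (n : ℕ), W.card + k = n → n = 0 → (b = 0 ∨ c = 0) →
          leftEnds W ∪ Z = ∅ := by
        intro W n h1 h2 h3
        have hW : W = ∅ := by rw [← card_eq_zero]; omega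
        rw [hI, if_pos h3, subset_empty] at hZ
        rw [hW, hZ]
        rfl
      have h1 := M_trapezoid (a + b) b 0 (by omega) (leftEnds X ∪ Z)
        (by rw [sub_zero]; exact_mod_cast union_subset hXI hZN)
        (fun h => hempty X b hbX h (Or.inl h))
      have h2 := M_trapezoid (a + b) c 0 (by omega) (leftEnds Y ∪ Z)
        (by rw [sub_zero]; exact_mod_cast union_subset hYI hZN)
        (fun h => hempty Y c hcY h (Or.inr h))
      rw [card_union_of_disjoint hdX, card_leftEnds] at h1
      rw [card_union_of_disjoint hdY, card_leftEnds] at h2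
      rw [dentedHexagon_upper, ← M_image_reflect (filter _ _ \ _), dentedHexagon_lower,
        mul_mul_mul_comm, h1, h2]
      by_cases hk : Z.card = k
      · rw [if_pos (by omega), if_pos (by omega), if_pos hk]
      · rw [if_neg (by omega), if_neg hk, zero_mul]
    rw [Nat.cast_sum, sum_mul]
    simp only [Nat.cast_mul]
    rw [sum_congr rfl hterm, ← sum_filter, ← powersetCard_eq_filter]
    by_cases h : b = 0 ∨ c = 0
    · have hk : k = 0 := by omega
      simp [hk]
    · rw [hI, if_neg h]
  · intro z
    have hz : z ∈ J ↔ (0 ≤ z ∧ z < a + b) ∧ z ∉ leftEnds X ∧ z ∉ leftEnds Y := by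
      rw [hJ, leftEnds_union, mem_sdiff, mem_union, mem_Ico]
      push_cast
      tauto
    rw [up_mem_dentedHexagon, down_mem_dentedHexagon, hI]
    split_ifs with h
    · simp only [notMem_empty, false_iff]
      omega
    · rw [hz]
      grind

/-! ### Invariance under shuffling. -/

/-- An element of both sets is counted twice on either side, any other element once. This is the
source of the invariance under shuffling. -/
theorem cross_mul_cross (S T Z : Finset ℤ) :
    cross S Z * cross T Z = cross (S ∪ T) Z * cross (S ∩ T) Z :=
  prod_union_inter.symm

theorem cross_pos {S Z : Finset ℤ} (h : Disjoint S Z) : 0 < cross S Z := by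
  refine prod_pos fun x hx => prod_pos fun z hz => abs_pos.2 (sub_ne_zero.2 ?_)
  rintro h'
  obtain rfl : x = z := by exact_mod_cast h'
  exact disjoint_left.1 h hx hz

/-- The sum that remains of the number of tilings of a dented hexagon when all factors that are not
invariant under shuffling are taken out. It depends on `P = X ∪ Y` and `Q = X ∩ Y` only. -/
noncomputable def shuffleSum (N k : ℕ) (P Q : Finset ℕ) : ℚ :=
  ∑ Z ∈ (Ico (0 : ℤ) N \ leftEnds P).powersetCard k,
    vdm Z ^ 2 * (cross (leftEnds P) Z * cross (leftEnds Q) Z)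

/-- All terms are positive, and there is at least one since k places are free outside P. Positivity
of the number of tilings comes from here. -/
theorem shuffleSum_pos {N k : ℕ} {P Q : Finset ℕ} (hP : P ⊆ Icc 1 N) (hQ : Q ⊆ P)
    (hk : k ≤ (Icc 1 N \ P).card) : 0 < shuffleSum N k P Q := by
  refine sum_pos ?_ ?_
  · intro Z hZ
    have hd : Disjoint (leftEnds P) Z :=
      (disjoint_of_subset_left (mem_powersetCard.1 hZ).1 sdiff_disjoint).symm
    have hd' : Disjoint (leftEnds Q) Z := disjoint_of_subset_left (image_subset_image hQ) hd
    have := vdm_pos Z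
    have := cross_pos hd
    have := cross_pos hd'
    positivity
  · rw [powersetCard_nonempty, card_sdiff_of_subset (leftEnds_subset hP), card_leftEnds,
      Int.card_Ico]
    rw [card_sdiff_of_subset hP, Nat.card_Icc] at hk
    omega

theorem M_dentedHexagon_mul {a b c k : ℕ} {X Y : Finset ℕ} (hX : X ⊆ Icc 1 (a + b))
    (hY : Y ⊆ Icc 1 (a + b)) (hc : c ≤ a + b) (hbX : X.card + k = b) (hcY : Y.card + k = c) :
    (M (dentedHexagon a b c X Y) : ℚ) * (H b * H c) =
      Δ X * Δ Y * shuffleSum (a + b) k (X ∪ Y) (X ∩ Y) := by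
  rw [M_dentedHexagon hX hY hc hbX hcY, shuffleSum, mul_sum]
  refine sum_congr rfl fun Z hZ => ?_
  have hd : Disjoint (leftEnds X ∪ leftEnds Y) Z := by
    rw [← leftEnds_union]
    exact (disjoint_of_subset_left (mem_powersetCard.1 hZ).1 sdiff_disjoint).symm
  rw [disjoint_union_left] at hd
  rw [leftEnds_union, leftEnds_inter, ← cross_mul_cross, vdm_union hd.1, vdm_union hd.2,
    vdm_leftEnds, vdm_leftEnds]
  ring

theorem Δ_pos (S : Finset ℕ) : 0 < Δ S := vdm_leftEnds S ▸ vdm_pos _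

/-! ### Flips and the theorem. -/

theorem IsFlip.isShuffling {X Y X' Y' : Finset ℕ} {d u : ℕ} (h : IsFlip X Y d u X' Y') :
    IsShuffling X Y X' Y' := by
  obtain ⟨D, U, hD, hU, -, -, rfl, rfl⟩ := h
  constructor
  · ext x
    have := @hD x
    have := @hU x
    simp only [mem_union, mem_sdiff] at *
    tauto
  · ext x
    have := @hD x
    have := @hU x
    simp only [mem_union, mem_sdiff, mem_inter] at *
    tauto

theorem IsFlip.card {X Y X' Y' : Finset ℕ} {d u : ℕ} (h : IsFlip X Y d u X' Y') :
    X'.card + d = X.card + u ∧ Y'.card + u = Y.card + d := by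
  obtain ⟨D, U, hD, hU, rfl, rfl, rfl, rfl⟩ := h
  have hDX := hD.trans sdiff_subset
  have hUY := hU.trans sdiff_subset
  have h1 : Disjoint (X \ D) U := disjoint_left.2 fun x hx hx' =>
    (mem_sdiff.1 (hU hx')).2 (mem_sdiff.1 hx).1
  have h2 : Disjoint (Y \ U) D := disjoint_left.2 fun x hx hx' =>
    (mem_sdiff.1 (hD hx')).2 (mem_sdiff.1 hx).1
  rw [card_union_of_disjoint h1, card_union_of_disjoint h2, card_sdiff_of_subset hDX,
    card_sdiff_of_subset hUY]
  have := card_le_card hDX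
  have := card_le_card hUY
  omega

end Shuffling

open Shuffling in
theorem theorem2p1 (a b c : ℕ) (X Y : Finset ℕ)
    (hX : X ⊆ Finset.Icc 1 (a + b)) (hY : Y ⊆ Finset.Icc 1 (a + b))
    (hc : c ≤ a + b)
    (hb_nonneg : 0 ≤ (b : ℤ) - X.card)
    (hbc : (b : ℤ) - X.card = (c : ℤ) - Y.card)
    (hroom : (c : ℤ) - Y.card ≤ (Finset.Icc 1 (a + b) \ (X ∪ Y)).card)
    (d u : ℕ) (X' Y' : Finset ℕ) (hflip : Shuffling.IsFlip X Y d u X' Y') :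
    Shuffling.IsShuffling X Y X' Y' ∧
    ∃ a' b' c' : ℕ,
      -- width and height are preserved, the diagonal moves up by `d - u` units
      a + b = a' + b' ∧ b + c = b' + c' ∧ (c' : ℤ) = c + ((d : ℤ) - u) ∧
      -- `V_{a',b',c'}(X',Y')` is a region of the same kind
      X' ⊆ Finset.Icc 1 (a' + b') ∧ Y' ⊆ Finset.Icc 1 (a' + b') ∧
      c' ≤ a' + b' ∧
      (b : ℤ) - X.card = (b' : ℤ) - X'.card ∧
      (b' : ℤ) - X'.card = (c' : ℤ) - Y'.card ∧
      0 ≤ (c' : ℤ) - Y'.card ∧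
      (c' : ℤ) - Y'.card ≤ (Finset.Icc 1 (a' + b') \ (X' ∪ Y')).card ∧
      -- the numbers of tilings
      0 < Shuffling.M (Shuffling.dentedHexagon a b c X Y) ∧
      (Shuffling.M (Shuffling.dentedHexagon a' b' c' X' Y') : ℚ) /
          (Shuffling.M (Shuffling.dentedHexagon a b c X Y) : ℚ) =
        (Shuffling.H b * Shuffling.H c) / (Shuffling.H b' * Shuffling.H c') *
          ((Shuffling.Δ X' * Shuffling.Δ Y') / (Shuffling.Δ X * Shuffling.Δ Y)) := by
  have hsh := hflip.isShuffling
  refine ⟨hsh, ?_⟩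
  obtain ⟨hcX, hcY⟩ := hflip.card
  have hXY : X ∪ Y ⊆ Finset.Icc 1 (a + b) := Finset.union_subset hX hY
  have hX' : X' ⊆ Finset.Icc 1 (a + b) := (Finset.subset_union_left.trans hsh.1.ge).trans hXY
  have hY' : Y' ⊆ Finset.Icc 1 (a + b) := (Finset.subset_union_right.trans hsh.1.ge).trans hXY
  -- With k the common excess, b = |X| + k and c = |Y| + k; the new parameters will be b' = |X'| + k
  -- and c' = |Y'| + k.
  obtain ⟨k, rfl⟩ : ∃ k, b = X.card + k := Nat.exists_eq_add_of_le (by omega)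
  obtain rfl : c = Y.card + k := by omega
  have hk : k ≤ (Finset.Icc 1 (a + (X.card + k)) \ (X ∪ Y)).card := by omega
  -- The k free places outside X ∪ Y leave room for b' and c' within the width; thus c' ≤ a' + b',
  -- and the subtraction defining a' does not truncate.
  have hbound : ∀ W, W ⊆ X ∪ Y → W.card + k ≤ a + (X.card + k) := by
    intro W hW
    have h1 := Finset.card_le_card hW
    have h2 := Finset.card_le_card hXY
    rw [Finset.card_sdiff_of_subset hXY] at hk
    rw [Nat.card_Icc] at hk h2
    omega
  have hb' := hbound X' (hsh.1 ▸ Finset.subset_union_left)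
  have hc' := hbound Y' (hsh.1 ▸ Finset.subset_union_right)
  have hab : a + (X.card + k) - (X'.card + k) + (X'.card + k) = a + (X.card + k) := by omega
  have hM := M_dentedHexagon_mul hX hY hc rfl rfl
  have hM' := M_dentedHexagon_mul (a := a + (X.card + k) - (X'.card + k)) (b := X'.card + k)
    (by rwa [hab]) (by rwa [hab]) (by rwa [hab]) rfl (rfl : Y'.card + k = _)
  rw [hab, ← hsh.1, ← hsh.2] at hM'
  have hW := shuffleSum_pos hXY (Finset.inter_subset_union (s := X) (t := Y)) hk
  set W := shuffleSum (a + (X.card + k)) k (X ∪ Y) (X ∩ Y)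
  have hHb := H_pos (X.card + k)
  have hHc := H_pos (Y.card + k)
  have hHb' := H_pos (X'.card + k)
  have hHc' := H_pos (Y'.card + k)
  have hΔX := Δ_pos X
  have hΔY := Δ_pos Y
  have hMpos : 0 < (M (dentedHexagon a (X.card + k) (Y.card + k) X Y) : ℚ) := by
    have h : 0 < Δ X * Δ Y * W := by positivity
    rw [← hM] at h
    exact pos_of_mul_pos_left h (by positivity)
  refine ⟨a + (X.card + k) - (X'.card + k), X'.card + k, Y'.card + k, by omega, by omega, by omega,
    by rwa [hab], by rwa [hab], by rwa [hab], by omega, by omega, by omega, ?_,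
    by exact_mod_cast hMpos, ?_⟩
  · rw [hab, ← hsh.1]
    omega
  · rw [div_mul_div_comm, div_eq_div_iff hMpos.ne' (by positivity)]
    have hH : 0 < W * (H (X.card + k) * H (Y.card + k)) := by positivity
    -- Multiplying by the common sum W makes both product formulas applicable to the
    -- cross-multiplied identity.
    refine mul_right_cancel₀ hW.ne' ?_
    linear_combination (Δ X * Δ Y * W) * hM' - (Δ X' * Δ Y' * W) * hM
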